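/- Fix $p,d\ge 1$ and $\epsilon\in(0,1/2)$. Let $\{Y_t\}_{t\ge1}$ be a strictly stationary time series in $\mathbb{R}^p$ (no change-point) with marginal distribution $F$, and let $\theta(\cdot)$ be an $\mathbb{R}^d$-valued functional of distributions on $\mathbb{R}^p$, with true value $\theta_0=\theta(F)$. For $1\le a\le b$ let $\widehat\theta_{a,b}=\theta(\widehat F_{a,b})$, where $\widehat F_{a,b}$ is the empirical distribution of $Y_a,\dots,Y_b$; these estimators are assumed to be measurable functions of the data. Let $\xi:\mathbb{R}^p\to\mathbb{R}^d$ be measurable (the influence function) and define the remainders $r_{a,b}$ by $$\widehat\theta_{a,b}=\theta_0+\frac1{b-a+1}\sum_{t=a}^b\xi(Y_t)+r_{a,b}.$$ Assume: (A1) for some positive definite $\Sigma\in\mathbb{R}^{d\times d}$, $n^{-1/2}\sum_{t=1}^{\lfloor nr\rfloor}\xi(Y_t)\Rightarrow\Sigma^{1/2}\mathcal{B}_d(r)$ weakly in $D([0,1],\mathbb{R}^d)$ with the Skorokhod topology, where $\mathcal{B}_d$ is a $d$-dimensional Brownian motion with independent entries; (A2) $\sup_{1\le a<b\le n}(b-a+1)\|r_{a,b}\|_2=o_p(n^{1/2})$.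 For $1\le t_1<k<t_2\le n$ put $N=t_2-t_1+1$ and $$D_n^*(t_1,k,t_2)=\frac{(k-t_1+1)(t_2-k)}{N^{3/2}}(\widehat\theta_{t_1,k}-\widehat\theta_{k+1,t_2}),\qquad V_n^*=L_n^*+R_n^*,$$ $$L_n^*(t_1,k,t_2)=\sum_{i=t_1}^{k}\frac{(i-t_1+1)^2(k-i)^2}{N^2(k-t_1+1)^2}(\widehat\theta_{t_1,i}-\widehat\theta_{i+1,k})(\widehat\theta_{t_1,i}-\widehat\theta_{i+1,k})^\top,$$ $$R_n^*(t_1,k,t_2)=\sum_{i=k+1}^{t_2}\frac{(t_2-i+1)^2(i-1-k)^2}{N^2(t_2-k)^2}(\widehat\theta_{i,t_2}-\widehat\theta_{k+1,i-1})(\widehat\theta_{i,t_2}-\widehat\theta_{k+1,i-1})^\top$$ (terms with weight zero are zero), and $T_n^*(t_1,k,t_2)=D_n^{*\top}V_n^{*-1}D_n^*$. With $h=\lfloor n\epsilon\rfloor$, let $H_{1:n}(k)$ be the set of pairs $(k-j_1h+1,\,k+j_2h)$ with $1\le j_1\le\lfloor k/h\rfloor$, $1\le j_2\le\lfloor (n-k)/h\rfloor$,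 and let $T_{1,n}^*(k)=\max_{(t_1,t_2)\in H_{1:n}(k)}T_n^*(t_1,k,t_2)$, where $\max_\varnothing:=0$. For the limit, let $\mathbf{\Delta}(u_1,u,u_2)=\mathcal{B}_d(u)-\mathcal{B}_d(u_1)-\frac{u-u_1}{u_2-u_1}[\mathcal{B}_d(u_2)-\mathcal{B}_d(u_1)]$, $D^*(u_1,u,u_2)=(u_2-u_1)^{-1/2}\mathbf{\Delta}(u_1,u,u_2)$, $$V^*(u_1,u,u_2)=\frac1{(u_2-u_1)^2}\Big(\int_{u_1}^{u}\mathbf{\Delta}(u_1,s,u)\mathbf{\Delta}(u_1,s,u)^\top ds+\int_{u}^{u_2}\mathbf{\Delta}(u,s,u_2)\mathbf{\Delta}(u,s,u_2)^\top ds\Big),$$ and let $H_\epsilon(u)$ be the set of pairs $(u-j_1\epsilon,\,u+j_2\epsilon)$ with $1\le j_1\le\lfloor u/\epsilon\rfloor$, $1\le j_2\le\lfloor(1-u)/\epsilon\rfloor$. Then, almost surely, $V^*(u_1,u,u_2)$ is positive definite for all $u\in[\epsilon,1-\epsilon]$ and $(u_1,u_2)\in H_\epsilon(u)$ and the supremum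 below is finite, and as $n\to\infty$ $$\max_{k=1,\dots,n}T_{1,n}^*(k)\overset{\mathcal D}{\longrightarrow}G_{\epsilon,d}^*=\sup_{u\in[\epsilon,1-\epsilon]}\ \max_{(u_1,u_2)\in H_\epsilon(u)}D^*(u_1,u,u_2)^\top V^*(u_1,u,u_2)^{-1}D^*(u_1,u,u_2).$$ If $1/\epsilon$ is not an integer, the same holds with the supremum taken over the open interval $(\epsilon,1-\epsilon)$. -/

import Mathlib

open MeasureTheory ProbabilityTheory Filter
open scoped Topology NNReal ENNReal Matrix

noncomputable section

namespace SNCP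

/-- The maximum of `f` over a finite set, with the convention that the maximum over `∅` is `0`. -/
def finMax {α : Type*} (S : Finset α) (f : α → ℝ) : ℝ :=
  if h : S.Nonempty then S.sup' h f else 0

/-! ### The space `D([0,1], ℝ^d)` with the Skorokhod topology -/

/-- Right-continuous functions on `[0,1]` with left limits. -/
def IsCadlag {d : ℕ} (x : unitInterval → EuclideanSpace ℝ (Fin d)) : Prop :=
  ∀ t, ContinuousWithinAt x (Set.Ici t) t ∧ ∃ l, Tendsto x (𝓝[<] t) (𝓝 l)

/-- The space `D([0,1], ℝ^d)` of càdlàg functions. -/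
structure DSpace (d : ℕ) where
  /-- the underlying function -/
  toFun : unitInterval → EuclideanSpace ℝ (Fin d)
  isCadlag : IsCadlag toFun

/-- The Skorokhod distance: the infimum, over increasing bijections `l` of `[0,1]` (which are
automatically homeomorphisms), of `max (sup_t |l t - t|) (sup_t ‖x t - y (l t)‖)`. -/
def skorokhodEDist {d : ℕ} (x y : DSpace d) : ℝ≥0∞ :=
  ⨅ l : unitInterval ≃o unitInterval,
    max (⨆ t, edist (l t) t) (⨆ t, edist (x.toFun t) (y.toFun (l t)))

theorem skorokhodEDist_self {d : ℕ} (x : DSpace d) : skorokhodEDist x x = 0 := by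
  refine le_antisymm ?_ zero_le
  refine (iInf_le _ (OrderIso.refl unitInterval)).trans ?_
  simp

theorem skorokhodEDist_comm_le {d : ℕ} (x y : DSpace d) :
    skorokhodEDist x y ≤ skorokhodEDist y x := by
  refine le_iInf fun l => (iInf_le _ l.symm).trans (max_le_max ?_ ?_)
  · refine iSup_le fun t => ?_
    have h := le_iSup (fun s => edist (l s) s) (l.symm t)
    simpa [edist_comm] using h
  · refine iSup_le fun t => ?_
    have h := le_iSup (fun s => edist (y.toFun s) (x.toFun (l s))) (l.symm t)
    simpa [edist_comm] using h

theorem skorokhodEDist_triangle {d : ℕ} (x y z : DSpace d) :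
    skorokhodEDist x z ≤ skorokhodEDist x y + skorokhodEDist y z := by
  refine ENNReal.le_iInf_add_iInf fun l m => (iInf_le _ (l.trans m)).trans (max_le ?_ ?_)
  · refine iSup_le fun t => ?_
    calc edist ((l.trans m) t) t ≤ edist (m (l t)) (l t) + edist (l t) t := edist_triangle _ _ _
      _ ≤ (⨆ t, edist (m t) t) + ⨆ t, edist (l t) t :=
          add_le_add (le_iSup (fun s => edist (m s) s) (l t)) (le_iSup (fun s => edist (l s) s) t)
      _ ≤ _ := by
          rw [add_comm]
          exact add_le_add (le_max_left _ _) (le_max_left _ _)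
  · refine iSup_le fun t => ?_
    calc edist (x.toFun t) (z.toFun ((l.trans m) t))
        ≤ edist (x.toFun t) (y.toFun (l t)) + edist (y.toFun (l t)) (z.toFun (m (l t))) :=
          edist_triangle _ _ _
      _ ≤ (⨆ t, edist (x.toFun t) (y.toFun (l t))) + ⨆ t, edist (y.toFun t) (z.toFun (m t)) :=
          add_le_add (le_iSup (fun s => edist (x.toFun s) (y.toFun (l s))) t)
            (le_iSup (fun s => edist (y.toFun s) (z.toFun (m s))) (l t))
      _ ≤ _ := add_le_add (le_max_right _ _) (le_max_right _ _)

/-- The Skorokhod metric, and with it the Skorokhod topology. -/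
instance (d : ℕ) : PseudoEMetricSpace (DSpace d) where
  edist := skorokhodEDist
  edist_self := skorokhodEDist_self
  edist_comm x y := le_antisymm (skorokhodEDist_comm_le x y) (skorokhodEDist_comm_le y x)
  edist_triangle := skorokhodEDist_triangle

instance (d : ℕ) : MeasurableSpace (DSpace d) := borel _

instance (d : ℕ) : BorelSpace (DSpace d) := ⟨rfl⟩

theorem isCadlag_of_continuous {d : ℕ} {x : unitInterval → EuclideanSpace ℝ (Fin d)}
    (hx : Continuous x) : IsCadlag x :=
  fun t => ⟨hx.continuousWithinAt, x t, hx.continuousAt.mono_left nhdsWithin_le_nhds⟩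

open scoped Classical in
/-- A continuous function as an element of `D([0,1], ℝ^d)`; the zero function if `x` is not
continuous. -/
def ofContinuous {d : ℕ} (x : unitInterval → EuclideanSpace ℝ (Fin d)) : DSpace d :=
  if hx : Continuous x then ⟨x, isCadlag_of_continuous hx⟩
  else ⟨fun _ => 0, isCadlag_of_continuous continuous_const⟩

theorem isCadlag_floor {d : ℕ} (n : ℕ) (g : ℕ → EuclideanSpace ℝ (Fin d)) :
    IsCadlag (fun r : unitInterval => g ⌊(n : ℝ) * r⌋₊) := by
  intro t
  have hc : Continuous (fun r : unitInterval => (n : ℝ) * r) := by fun_prop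
  constructor
  · have h1 : ∀ᶠ r : unitInterval in 𝓝[≥] t, (n : ℝ) * r < ⌊(n : ℝ) * t⌋₊ + 1 :=
      (hc.continuousAt.mono_left nhdsWithin_le_nhds).eventually_lt_const (Nat.lt_floor_add_one _)
    have h2 : (fun r : unitInterval => g ⌊(n : ℝ) * r⌋₊) =ᶠ[𝓝[≥] t]
        fun _ => g ⌊(n : ℝ) * t⌋₊ := by
      filter_upwards [h1, self_mem_nhdsWithin] with r hr hrt
      have hrt' : (t : ℝ) ≤ r := hrt
      have h0 : (0 : ℝ) ≤ n * r := mul_nonneg n.cast_nonneg r.2.1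
      have : ⌊(n : ℝ) * r⌋₊ = ⌊(n : ℝ) * t⌋₊ :=
        (Nat.floor_eq_iff h0).2 ⟨(Nat.floor_le (mul_nonneg n.cast_nonneg t.2.1)).trans
          (mul_le_mul_of_nonneg_left hrt' n.cast_nonneg), hr⟩
      rw [this]
    exact tendsto_const_nhds.congr' h2.symm
  · refine ⟨g (⌈(n : ℝ) * t⌉₊ - 1), tendsto_const_nhds.congr' ?_⟩
    rcases Nat.eq_zero_or_pos ⌈(n : ℝ) * t⌉₊ with h0 | hpos
    · filter_upwards [self_mem_nhdsWithin] with r hr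
      have hr' : (r : ℝ) ≤ t := le_of_lt hr
      have : (n : ℝ) * r ≤ 0 :=
        (mul_le_mul_of_nonneg_left hr' n.cast_nonneg).trans (Nat.ceil_eq_zero.1 h0)
      rw [h0, Nat.floor_of_nonpos this]
    · have hlt : ((⌈(n : ℝ) * t⌉₊ - 1 : ℕ) : ℝ) < n * t :=
        Nat.lt_ceil.1 (Nat.sub_lt hpos Nat.one_pos)
      have hn : (0 : ℝ) < n := by
        rcases Nat.eq_zero_or_pos n with rfl | h
        · simp at hpos
        · exact_mod_cast h
      have h1 : ∀ᶠ r in 𝓝[<] t, ((⌈(n : ℝ) * t⌉₊ - 1 : ℕ) : ℝ) < n * (r : unitInterval) :=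
        (hc.continuousAt.mono_left nhdsWithin_le_nhds).eventually_const_lt hlt
      filter_upwards [h1, self_mem_nhdsWithin] with r hr hrt
      have hrt' : (r : ℝ) < t := hrt
      have h2 : (n : ℝ) * r < ⌈(n : ℝ) * t⌉₊ :=
        (mul_lt_mul_of_pos_left hrt' hn).trans_le (Nat.le_ceil _)
      have : ⌊(n : ℝ) * r⌋₊ = ⌈(n : ℝ) * t⌉₊ - 1 := by
        refine (Nat.floor_eq_iff (mul_nonneg n.cast_nonneg r.2.1)).2 ⟨hr.le, ?_⟩
        have : ((⌈(n : ℝ) * t⌉₊ - 1 : ℕ) : ℝ) + 1 = ⌈(n : ℝ) * t⌉₊ := by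
          exact_mod_cast Nat.sub_add_cancel hpos
        rw [this]
        exact h2
      rw [this]

/-! ### The sample, the estimators and the self-normalized statistic

`y : ℕ → ℝ^p` is an observed path; the observations are `y 1, y 2, …` (`y 0` is never used). -/

section Sample

variable {p d : ℕ}

/-- The path `r ↦ n^{-1/2} ∑_{t=1}^{⌊n r⌋} ξ(y_t)` in `D([0,1], ℝ^d)`. -/
def partialSumPath (ξ : EuclideanSpace ℝ (Fin p) → EuclideanSpace ℝ (Fin d)) (n : ℕ)
    (y : ℕ → EuclideanSpace ℝ (Fin p)) : DSpace d where
  toFun r := (√(n : ℝ))⁻¹ • ∑ t ∈ Finset.Icc 1 ⌊(n : ℝ) * r⌋₊, ξ (y t)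
  isCadlag := isCadlag_floor n fun m => (√(n : ℝ))⁻¹ • ∑ t ∈ Finset.Icc 1 m, ξ (y t)

/-- The empirical distribution of `y a, …, y b` (a probability measure when `a ≤ b`). -/
def empirical (y : ℕ → EuclideanSpace ℝ (Fin p)) (a b : ℕ) :
    Measure (EuclideanSpace ℝ (Fin p)) :=
  ((b + 1 - a : ℕ) : ℝ≥0∞)⁻¹ • ∑ t ∈ Finset.Icc a b, Measure.dirac (y t)

/-- The subsample estimator: the functional `θ` at the empirical distribution of `y a, …, y b`. -/
def thetaHat (θ : Measure (EuclideanSpace ℝ (Fin p)) → EuclideanSpace ℝ (Fin d))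
    (y : ℕ → EuclideanSpace ℝ (Fin p)) (a b : ℕ) : EuclideanSpace ℝ (Fin d) :=
  θ (empirical y a b)

/-- The remainder `r_{a,b}` of the expansion
`thetaHat_{a,b} = θ₀ + (b - a + 1)⁻¹ ∑_{t=a}^{b} ξ(y_t) + r_{a,b}`. -/
def remainder (θ : Measure (EuclideanSpace ℝ (Fin p)) → EuclideanSpace ℝ (Fin d))
    (θ₀ : EuclideanSpace ℝ (Fin d))
    (ξ : EuclideanSpace ℝ (Fin p) → EuclideanSpace ℝ (Fin d))
    (y : ℕ → EuclideanSpace ℝ (Fin p)) (a b : ℕ) : EuclideanSpace ℝ (Fin d) :=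
  thetaHat θ y a b - θ₀ - ((b : ℝ) - a + 1)⁻¹ • ∑ t ∈ Finset.Icc a b, ξ (y t)

/-- `sup_{1 ≤ a < b ≤ n} (b - a + 1) ‖r_{a,b}‖₂`. -/
def supRemainder (θ : Measure (EuclideanSpace ℝ (Fin p)) → EuclideanSpace ℝ (Fin d))
    (θ₀ : EuclideanSpace ℝ (Fin d))
    (ξ : EuclideanSpace ℝ (Fin p) → EuclideanSpace ℝ (Fin d)) (n : ℕ)
    (y : ℕ → EuclideanSpace ℝ (Fin p)) : ℝ :=
  finMax ((Finset.Icc 1 n ×ˢ Finset.Icc 1 n).filter fun q => q.1 < q.2) fun q =>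
    ((q.2 : ℝ) - q.1 + 1) * ‖remainder θ θ₀ ξ y q.1 q.2‖

/-- The outer product `v vᵀ`. -/
def outer (v : EuclideanSpace ℝ (Fin d)) : Matrix (Fin d) (Fin d) ℝ :=
  Matrix.vecMulVec v.ofLp v.ofLp

variable (θ : Measure (EuclideanSpace ℝ (Fin p)) → EuclideanSpace ℝ (Fin d))
  (y : ℕ → EuclideanSpace ℝ (Fin p))

/-- The contrast statistic `D_n^*(t₁, k, t₂)`. -/
def contrast (t₁ k t₂ : ℕ) : EuclideanSpace ℝ (Fin d) :=
  (((k : ℝ) - t₁ + 1) * ((t₂ : ℝ) - k) / ((t₂ : ℝ) - t₁ + 1) ^ (3 / 2 : ℝ)) •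
    (thetaHat θ y t₁ k - thetaHat θ y (k + 1) t₂)

/-- The left part `L_n^*(t₁, k, t₂)` of the self-normalizer. -/
def leftNormalizer (t₁ k t₂ : ℕ) : Matrix (Fin d) (Fin d) ℝ :=
  ∑ i ∈ Finset.Icc t₁ k,
    ((((i : ℝ) - t₁ + 1) ^ 2 * ((k : ℝ) - i) ^ 2) /
      (((t₂ : ℝ) - t₁ + 1) ^ 2 * ((k : ℝ) - t₁ + 1) ^ 2)) •
      outer (thetaHat θ y t₁ i - thetaHat θ y (i + 1) k)

/-- The right part `R_n^*(t₁, k, t₂)` of the self-normalizer. -/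
def rightNormalizer (t₁ k t₂ : ℕ) : Matrix (Fin d) (Fin d) ℝ :=
  ∑ i ∈ Finset.Icc (k + 1) t₂,
    ((((t₂ : ℝ) - i + 1) ^ 2 * ((i : ℝ) - 1 - k) ^ 2) /
      (((t₂ : ℝ) - t₁ + 1) ^ 2 * ((t₂ : ℝ) - k) ^ 2)) •
      outer (thetaHat θ y i t₂ - thetaHat θ y (k + 1) (i - 1))

/-- The self-normalizer `V_n^* = L_n^* + R_n^*`. -/
def normalizer (t₁ k t₂ : ℕ) : Matrix (Fin d) (Fin d) ℝ :=
  leftNormalizer θ y t₁ k t₂ + rightNormalizer θ y t₁ k t₂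

/-- The statistic `T_n^*(t₁, k, t₂) = D_n^*ᵀ (V_n^*)⁻¹ D_n^*`. -/
def snStat (t₁ k t₂ : ℕ) : ℝ :=
  (contrast θ y t₁ k t₂).ofLp ⬝ᵥ
    ((normalizer θ y t₁ k t₂)⁻¹ *ᵥ (contrast θ y t₁ k t₂).ofLp)

/-- The window size `h = ⌊n ε⌋`. -/
def windowSize (ε : ℝ) (n : ℕ) : ℕ := ⌊(n : ℝ) * ε⌋₊

/-- The nested window set `H_{1:n}(k)` of all pairs `(k - j₁ h + 1, k + j₂ h)` with
`1 ≤ j₁ ≤ ⌊k / h⌋` and `1 ≤ j₂ ≤ ⌊(n - k) / h⌋`. -/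
def nestedWindows (ε : ℝ) (n k : ℕ) : Finset (ℕ × ℕ) :=
  (Finset.Icc 1 (k / windowSize ε n) ×ˢ Finset.Icc 1 ((n - k) / windowSize ε n)).image
    fun j => (k - j.1 * windowSize ε n + 1, k + j.2 * windowSize ε n)

/-- The statistic `max_{k=1,…,n} T_{1,n}^*(k)`, where `T_{1,n}^*(k)` is the maximum of
`T_n^*(t₁, k, t₂)` over the nested window set of `k`. -/
def maxSN (ε : ℝ) (n : ℕ) : ℝ :=
  finMax (Finset.Icc 1 n) fun k => finMax (nestedWindows ε n k) fun q => snStat θ y q.1 k q.2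

end Sample

/-! ### The limit

`w : ℝ → ℝ^d` is a path of which only the values on `[0,1]` are used. -/

section Limit

variable {d : ℕ} (w : ℝ → Fin d → ℝ)

/-- `Δ(u₁, u, u₂) = w(u) - w(u₁) - (u - u₁)/(u₂ - u₁) (w(u₂) - w(u₁))`. -/
def bridge (u₁ u u₂ : ℝ) : Fin d → ℝ :=
  w u - w u₁ - ((u - u₁) / (u₂ - u₁)) • (w u₂ - w u₁)

/-- `D^*(u₁, u, u₂)`. -/
def limitContrast (u₁ u u₂ : ℝ) : Fin d → ℝ := (√(u₂ - u₁))⁻¹ • bridge w u₁ u u₂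

/-- `V^*(u₁, u, u₂)`, with entrywise integrals. -/
def limitNormalizer (u₁ u u₂ : ℝ) : Matrix (Fin d) (Fin d) ℝ :=
  ((u₂ - u₁) ^ 2)⁻¹ • Matrix.of fun i j =>
    (∫ s in u₁..u, bridge w u₁ s u i * bridge w u₁ s u j) +
      ∫ s in u..u₂, bridge w u s u₂ i * bridge w u s u₂ j

/-- `D^*ᵀ (V^*)⁻¹ D^*`. -/
def limitStat (u₁ u u₂ : ℝ) : ℝ :=
  limitContrast w u₁ u u₂ ⬝ᵥ ((limitNormalizer w u₁ u u₂)⁻¹ *ᵥ limitContrast w u₁ u u₂)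

/-- The scaled window set `H_ε(u)` of all pairs `(u - j₁ ε, u + j₂ ε)` with
`1 ≤ j₁ ≤ ⌊u / ε⌋` and `1 ≤ j₂ ≤ ⌊(1 - u) / ε⌋`. -/
def limitWindows (ε u : ℝ) : Finset (ℝ × ℝ) :=
  (Finset.Icc 1 ⌊u / ε⌋₊ ×ˢ Finset.Icc 1 ⌊(1 - u) / ε⌋₊).image
    fun j => (u - j.1 * ε, u + j.2 * ε)

/-- `max_{(u₁, u₂) ∈ H_ε(u)} D^*(u₁, u, u₂)ᵀ V^*(u₁, u, u₂)⁻¹ D^*(u₁, u, u₂)`. -/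
def limitMax (ε u : ℝ) : ℝ := finMax (limitWindows ε u) fun q => limitStat w q.1 u q.2

/-- `sup_{u ∈ U} max_{(u₁, u₂) ∈ H_ε(u)} D^*ᵀ (V^*)⁻¹ D^*`. -/
def limitSup (ε : ℝ) (U : Set ℝ) : ℝ := ⨆ u : U, limitMax w ε u

end Limit

/-! ### Probabilistic notions -/

/-- Strict stationarity of `Y 1, Y 2, …`. -/
def IsStationary {Ω E : Type*} [MeasurableSpace Ω] [MeasurableSpace E] (Y : ℕ → Ω → E)
    (P : Measure Ω) : Prop :=
  ∀ m : ℕ, IdentDistrib (fun ω (t : ℕ) => Y (t + 1 + m) ω) (fun ω (t : ℕ) => Y (t + 1) ω) P P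

/-- A `d`-dimensional standard Brownian motion: independent one-dimensional Brownian motions. -/
structure IsBrownianVec {Ω : Type*} [MeasurableSpace Ω] {d : ℕ} (B : Fin d → ℝ≥0 → Ω → ℝ)
    (P : Measure Ω) : Prop where
  isBrownian : ∀ i, IsBrownianReal (B i) P
  indep : iIndepFun (fun i ω (t : ℝ≥0) => B i t ω) P

/-- The path of `B` at `ω`, on the real time axis. -/
def pathOf {Ω : Type*} {d : ℕ} (B : Fin d → ℝ≥0 → Ω → ℝ) (ω : Ω) : ℝ → Fin d → ℝ :=
  fun s i => B i s.toNNReal ω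

open scoped MatrixOrder in
/-- The positive semidefinite square root of a positive semidefinite matrix. -/
def matrixSqrt {d : ℕ} (S : Matrix (Fin d) (Fin d) ℝ) : Matrix (Fin d) (Fin d) ℝ := CFC.sqrt S

/-- The path `r ↦ S^{1/2} B(r)`, `r ∈ [0,1]`, in `D([0,1], ℝ^d)`. -/
def scaledPath {Ω : Type*} {d : ℕ} (S : Matrix (Fin d) (Fin d) ℝ) (B : Fin d → ℝ≥0 → Ω → ℝ)
    (ω : Ω) : DSpace d :=
  ofContinuous fun r => WithLp.toLp 2 (matrixSqrt S *ᵥ pathOf B ω r)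

end SNCP

end

noncomputable section

namespace SNCP

section

/-! ### Uniform convergence tested along ultrafilters -/

/-! The estimators enter only through differences over adjacent blocks, in which `θ₀` cancels. After
division by `√n`, such a difference is the bridge of the partial sum path plus a remainder
(`scaledDiff_eq`), so the statistic is nearly the functional `limitStat` of the partial sum path,
with Riemann sums in place of integrals. If the paths converge uniformly to a continuous path with
invertible normalizers (`IsRegular`), one expects the maximum to converge to `limitSup`. Since
`limitStat` is unchanged by an invertible linear map of the path (`limitStat_mulVec`), `Σ^{1/2}`
disappears from the limit.

The difficulty is that (A2) controls only blocks of at least two observations, while the normalizer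
also contains blocks of one observation. The two halves of the convergence avoid uniform control of
these in different ways. For the upper bound, the offending terms are positive semidefinite, and
deleting them only increases the inverse quadratic form (`invForm_add_le`, `IsApprox.le_limitStat`).
For the lower bound, continuity in `u` reduces matters to countably many sequences of split points
(`exists_grid_near`); along each, stationarity gives the four boundary remainders fixed laws, so
they are `o_p(n)`, which suffices because the corresponding terms carry a factor `1/n`
(`IsApprox.tendsto_snStat`). Together these give the deterministic statement
`IsApprox.tendsto_maxSN`.

Randomness enters through an extended continuous mapping theorem
(`tendstoInDistribution_of_forall_filter`), which combines convergence in law of the paths with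
countably many remainders tending to zero in probability, and asks for the deterministic convergence
along arbitrary filters on pairs (sample size, outcome).

Almost sure regularity of the Brownian path (`IsBrownianVec.ae_posDef`) holds because a degenerate
normalizer forces some nonzero combination of the components to be affine on an interval. Its
increments over equal subintervals would then coincide, which independent Gaussian increments
exclude simultaneously for all rational intervals. -/

/-- Convergence may be tested on ultrafilters, and along an ultrafilter the positions converge by
compactness. Continuous convergence thus becomes uniform convergence. -/
theorem tendsto_sub_zero_of_ultrafilter {κ E : Type*} [NormedAddCommGroup E] {L : Filter κ}
    {K : Set ℝ} (hK : IsCompact K) {pos : κ → ℝ} (hpos : ∀ᶠ x in L, pos x ∈ K) {φ : ℝ → E}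
    (hφ : Continuous φ) {h : κ → E}
    (H : ∀ U : Ultrafilter κ, ↑U ≤ L → ∀ s, Tendsto pos U (𝓝 s) → Tendsto h U (𝓝 (φ s))) :
    Tendsto (fun x => h x - φ (pos x)) L (𝓝 0) := by
  rw [tendsto_iff_ultrafilter]
  intro U hU
  obtain ⟨s, -, hs⟩ := hK.ultrafilter_le_nhds' (U.map pos) (hU hpos)
  have hs' : Tendsto pos U (𝓝 s) := hs
  simpa using (H U hU s hs').sub ((hφ.tendsto s).comp hs')

theorem tendsto_intervalIntegral_of_ultrafilter {ι : Type*} {l : Filter ι} {G : ι → ℝ → ℝ}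
    {g : ℝ → ℝ} (hg : Continuous g) (hG : ∀ i, Continuous (G i)) {a b : ι → ℝ}
    {α β : ℝ} (ha : Tendsto a l (𝓝 α)) (hb : Tendsto b l (𝓝 β)) (hαβ : α ≤ β)
    (H : ∀ U : Ultrafilter (ι × ℝ), Tendsto Prod.fst (U : Filter (ι × ℝ)) l →
      ∀ s, Tendsto Prod.snd (U : Filter (ι × ℝ)) (𝓝 s) →
        Tendsto (fun x : ι × ℝ => G x.1 x.2) U (𝓝 (g s))) :
    Tendsto (fun i => ∫ s in a i..b i, G i s) l (𝓝 (∫ s in α..β, g s)) := by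
  set K := Set.Icc (α - 1) (β + 1)
  -- Convergence along this filter means convergence in `i` uniformly in the second coordinate over
  -- `K`, which eventually contains every interval of integration.
  have h1 : Tendsto (fun x : ι × ℝ => G x.1 x.2 - g x.2)
      (comap Prod.fst l ⊓ 𝓟 {x | x.2 ∈ K}) (𝓝 0) := by
    refine tendsto_sub_zero_of_ultrafilter (K := K) isCompact_Icc ?_ hg ?_
    · exact mem_inf_of_right (mem_principal_self _)
    · intro U hU s hs
      exact H U (tendsto_iff_comap.2 (hU.trans inf_le_left)) s hs
  have h2 : Tendsto (fun i => ∫ s in a i..b i, g s) l (𝓝 (∫ s in α..β, g s)) := by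
    have hc : Continuous fun x => ∫ s in (0 : ℝ)..x, g s :=
      intervalIntegral.continuous_primitive (fun _ _ => hg.intervalIntegrable _ _) 0
    have h3 : ∀ x y, ∫ s in x..y, g s = (∫ s in (0 : ℝ)..y, g s) - ∫ s in (0 : ℝ)..x, g s :=
      fun x y => (intervalIntegral.integral_interval_sub_left
        (hg.intervalIntegrable _ _) (hg.intervalIntegrable _ _)).symm
    rw [h3]
    refine Tendsto.congr (fun i => (h3 _ _).symm) ?_
    exact ((hc.tendsto β).comp hb).sub ((hc.tendsto α).comp ha)
  have h3 : Tendsto (fun i => ∫ s in a i..b i, (G i s - g s)) l (𝓝 0) := by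
    rw [Metric.tendsto_nhds]
    intro δ hδ
    have hlen : 0 < β - α + 3 := by linarith
    have h4 := (Metric.tendsto_nhds.1 h1) (δ / (β - α + 3)) (by positivity)
    rw [eventually_inf_principal] at h4
    have h4' := eventually_comap.1 h4
    filter_upwards [h4',
      ha.eventually (Ioo_mem_nhds (by linarith : α - 1 < α) (by linarith : α < α + 1)),
      hb.eventually (Ioo_mem_nhds (by linarith : β - 1 < β) (by linarith : β < β + 1))] with i hi hai hbi
    have h5 : ‖∫ s in a i..b i, (G i s - g s)‖ ≤ δ / (β - α + 3) * |b i - a i| := by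
      refine intervalIntegral.norm_integral_le_of_norm_le_const fun s hs => ?_
      have hsK : s ∈ K := by
        have := Set.uIoc_subset_uIcc hs
        rw [Set.mem_uIcc] at this
        constructor
        · rcases this with h | h <;> linarith [hai.1, hbi.1, h.1]
        · rcases this with h | h <;> linarith [hai.2, hbi.2, h.2]
      have := hi (i, s) rfl hsK
      rw [dist_zero_right] at this
      exact this.le
    rw [dist_zero_right]
    refine h5.trans_lt ?_
    have h6 : |b i - a i| < β - α + 3 := by
      rw [abs_lt]
      constructor <;> linarith [hai.1, hbi.1, hai.2, hbi.2]
    calc δ / (β - α + 3) * |b i - a i| < δ / (β - α + 3) * (β - α + 3) := by gcongr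
      _ = δ := by field_simp
  have h4 := h3.add h2
  rw [zero_add] at h4
  refine h4.congr fun i => ?_
  rw [intervalIntegral.integral_sub ((hG i).intervalIntegrable _ _) (hg.intervalIntegrable _ _)]
  ring

/-- Each summand `g i m` is compared with `φ` at every real point of the cell `[m/n, (m+1)/n]`,
uniformly over cells; hence the triples `(i, m, s)`. The error is a uniform bound times the total
length of the cells. -/
theorem tendsto_riemannSum_of_ultrafilter {ι : Type*} {l : Filter ι} {n a b : ι → ℕ}
    (hn : Tendsto n l atTop) {α β : ℝ} (ha : Tendsto (fun i => (a i : ℝ) / n i) l (𝓝 α))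
    (hb : Tendsto (fun i => (b i : ℝ) / n i) l (𝓝 β)) (hab : ∀ᶠ i in l, a i ≤ b i)
    {g : ι → ℕ → ℝ} {φ : ℝ → ℝ} (hφ : Continuous φ)
    (H : ∀ U : Ultrafilter (ι × ℕ), Tendsto Prod.fst (U : Filter (ι × ℕ)) l →
      (∀ᶠ x in (U : Filter (ι × ℕ)), a x.1 ≤ x.2 ∧ x.2 < b x.1) →
      ∀ s, Tendsto (fun x : ι × ℕ => (x.2 : ℝ) / n x.1) U (𝓝 s) →
        Tendsto (fun x : ι × ℕ => g x.1 x.2) U (𝓝 (φ s))) :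
    Tendsto (fun i => (n i : ℝ)⁻¹ * ∑ m ∈ Finset.Ico (a i) (b i), g i m) l
      (𝓝 (∫ s in α..β, φ s)) := by
  set K := Set.Icc (α - 1) (β + 1)
  have hninv : Tendsto (fun i => ((n i : ℝ))⁻¹) l (𝓝 0) :=
    tendsto_inv_atTop_zero.comp (tendsto_natCast_atTop_atTop.comp hn)
  have hnpos : ∀ᶠ i in l, 0 < n i := hn.eventually_gt_atTop 0
  set P : Set (ι × ℕ × ℝ) := {x | (a x.1 ≤ x.2.1 ∧ x.2.1 < b x.1) ∧
    (x.2.1 : ℝ) / n x.1 ≤ x.2.2 ∧ x.2.2 ≤ ((x.2.1 + 1 : ℕ) : ℝ) / n x.1}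
  have hai := ha.eventually (lt_mem_nhds (by linarith : α - 1 < α))
  have hbi := hb.eventually (gt_mem_nhds (by linarith : β < β + 1))
  have h1 : Tendsto (fun x : ι × ℕ × ℝ => g x.1 x.2.1 - φ x.2.2)
      (comap Prod.fst l ⊓ 𝓟 P) (𝓝 0) := by
    refine tendsto_sub_zero_of_ultrafilter (K := K) isCompact_Icc ?_ hφ ?_
    · rw [eventually_inf_principal]
      filter_upwards [tendsto_comap.eventually hai, tendsto_comap.eventually hbi,
        tendsto_comap.eventually hnpos] with x h1 h2 h3 hx
      have h3' : (0 : ℝ) < n x.1 := by exact_mod_cast h3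
      refine ⟨h1.le.trans (le_trans ?_ hx.2.1), hx.2.2.trans (le_trans ?_ h2.le)⟩
      · gcongr; exact hx.1.1
      · gcongr; exact hx.1.2
    · intro U hU s hs
      have hfst : Tendsto Prod.fst (U : Filter (ι × ℕ × ℝ)) l :=
        tendsto_iff_comap.2 (hU.trans inf_le_left)
      have hP : ∀ᶠ x in (U : Filter (ι × ℕ × ℝ)), x ∈ P :=
        (hU.trans inf_le_right) (mem_principal_self P)
      have hq : Tendsto (fun x : ι × ℕ × ℝ => (x.2.1 : ℝ) / n x.1) U (𝓝 s) := by
        have hlow : Tendsto (fun x : ι × ℕ × ℝ => x.2.2 - ((n x.1 : ℝ))⁻¹) U (𝓝 s) := by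
          simpa using hs.sub (hninv.comp hfst)
        refine tendsto_of_tendsto_of_tendsto_of_le_of_le' hlow hs ?_ ?_
        · filter_upwards [hP] with x hx
          have := hx.2.2
          rw [Nat.cast_add, add_div, Nat.cast_one, one_div] at this
          linarith
        · filter_upwards [hP] with x hx using hx.2.1
      let V : Ultrafilter (ι × ℕ) := U.map fun x => (x.1, x.2.1)
      refine H V ?_ ?_ s ?_
      · exact hfst
      · exact hP.mono fun x hx => hx.1
      · exact hq
  have h2 : Tendsto (fun i => ∫ s in ((a i : ℝ) / n i)..((b i : ℝ) / n i), φ s) l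
      (𝓝 (∫ s in α..β, φ s)) := by
    have hc : Continuous fun x => ∫ s in (0 : ℝ)..x, φ s :=
      intervalIntegral.continuous_primitive (fun _ _ => hφ.intervalIntegrable _ _) 0
    have h3 : ∀ x y, ∫ s in x..y, φ s = (∫ s in (0 : ℝ)..y, φ s) - ∫ s in (0 : ℝ)..x, φ s :=
      fun x y => (intervalIntegral.integral_interval_sub_left
        (hφ.intervalIntegrable _ _) (hφ.intervalIntegrable _ _)).symm
    rw [h3]
    refine Tendsto.congr (fun i => (h3 _ _).symm) ?_
    exact ((hc.tendsto β).comp hb).sub ((hc.tendsto α).comp ha)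
  have h3 : Tendsto (fun i => (n i : ℝ)⁻¹ * ∑ m ∈ Finset.Ico (a i) (b i), g i m -
      ∫ s in ((a i : ℝ) / n i)..((b i : ℝ) / n i), φ s) l (𝓝 0) := by
    rw [Metric.tendsto_nhds]
    intro δ hδ
    have hlen : 0 < |β - α| + 3 := by positivity
    have h4 := (Metric.tendsto_nhds.1 h1) (δ / (|β - α| + 3)) (by positivity)
    rw [eventually_inf_principal] at h4
    have h4' := eventually_comap.1 h4
    filter_upwards [h4', hai, hbi, hnpos, hab] with i hi h1i h2i h3i hab'
    have h3' : (0 : ℝ) < n i := by exact_mod_cast h3i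
    have hsum := intervalIntegral.sum_integral_adjacent_intervals_Ico (f := φ) (μ := volume)
      (a := fun m : ℕ => (m : ℝ) / n i) (m := a i) (n := b i) hab'
      (fun _ _ => hφ.intervalIntegrable _ _)
    rw [← hsum, Finset.mul_sum, ← Finset.sum_sub_distrib, dist_zero_right]
    have hterm : ∀ m ∈ Finset.Ico (a i) (b i), ‖(n i : ℝ)⁻¹ * g i m -
        ∫ s in ((m : ℝ) / n i)..(((m + 1 : ℕ) : ℝ) / n i), φ s‖ ≤
          δ / (|β - α| + 3) * (n i : ℝ)⁻¹ := by
      intro m hm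
      rw [Finset.mem_Ico] at hm
      have hdiff : ((m + 1 : ℕ) : ℝ) / n i - (m : ℝ) / n i = (n i : ℝ)⁻¹ := by
        push_cast; field_simp; ring
      have e : (n i : ℝ)⁻¹ * g i m = ∫ s in ((m : ℝ) / n i)..(((m + 1 : ℕ) : ℝ) / n i), g i m := by
        rw [intervalIntegral.integral_const, hdiff, smul_eq_mul]
      rw [e, ← intervalIntegral.integral_sub (by simp) (hφ.intervalIntegrable _ _)]
      have hle : (m : ℝ) / n i ≤ ((m + 1 : ℕ) : ℝ) / n i := by
        have : (0 : ℝ) < (n i : ℝ)⁻¹ := by positivity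
        linarith
      refine (intervalIntegral.norm_integral_le_of_norm_le_const
        (C := δ / (|β - α| + 3)) fun s hs => ?_).trans ?_
      · rw [Set.uIoc_of_le hle] at hs
        have := hi (i, m, s) rfl ⟨hm, hs.1.le, hs.2⟩
        rw [dist_zero_right] at this
        exact this.le
      · rw [hdiff, abs_of_pos (inv_pos.2 h3')]
    refine (norm_sum_le_of_le _ hterm).trans_lt ?_
    rw [Finset.sum_const, nsmul_eq_mul, Nat.card_Ico, Nat.cast_sub hab']
    have h6 : ((b i : ℝ) - a i) * (n i : ℝ)⁻¹ < |β - α| + 3 := by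
      have := le_abs_self (β - α)
      rw [sub_mul, ← div_eq_mul_inv, ← div_eq_mul_inv]
      linarith
    calc ((b i : ℝ) - a i) * (δ / (|β - α| + 3) * (n i : ℝ)⁻¹)
        = δ / (|β - α| + 3) * (((b i : ℝ) - a i) * (n i : ℝ)⁻¹) := by ring
      _ < δ / (|β - α| + 3) * (|β - α| + 3) := by gcongr
      _ = δ := by field_simp
  simpa using h3.add h2

theorem _root_.TendstoUniformly.comp_index {ι κ α β : Type*} [UniformSpace β] {F : ι → α → β}
    {f : α → β} {l : Filter ι} (h : TendstoUniformly F f l) {L : Filter κ} {j : κ → ι}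
    (hj : Tendsto j L l) : TendstoUniformly (fun x => F (j x)) f L :=
  fun u hu => hj.eventually (h u hu)

/-! ### Continuity of the limiting statistic in the path and the window -/

variable {d : ℕ}

/-- Only the limit path has to be continuous, so this applies to partial sum paths, which jump. -/
theorem tendsto_bridge {κ : Type*} {L : Filter κ} {F : κ → ℝ → Fin d → ℝ} {w : ℝ → Fin d → ℝ}
    (hw : Continuous w) (hF : TendstoUniformly F w L) {a s b : κ → ℝ} {α σ β : ℝ} (hne : α ≠ β)
    (ha : Tendsto a L (𝓝 α)) (hs : Tendsto s L (𝓝 σ)) (hb : Tendsto b L (𝓝 β)) :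
    Tendsto (fun x => bridge (F x) (a x) (s x) (b x)) L (𝓝 (bridge w α σ β)) := by
  have h1 := hF.tendsto_comp hw.continuousAt ha
  have h2 := hF.tendsto_comp hw.continuousAt hs
  have h3 := hF.tendsto_comp hw.continuousAt hb
  exact (h2.sub h1).sub (((hs.sub ha).div (hb.sub ha) (sub_ne_zero.2 hne.symm)).smul (h3.sub h1))

theorem continuous_bridge {w : ℝ → Fin d → ℝ} (hw : Continuous w) (a b : ℝ) :
    Continuous fun s => bridge w a s b := by
  unfold bridge
  fun_prop

/-- The matrix of integrals `∫_a^b Δ(a, s, b) Δ(a, s, b)ᵀ ds`. -/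
def bridgeGram (w : ℝ → Fin d → ℝ) (a b : ℝ) : Matrix (Fin d) (Fin d) ℝ :=
  Matrix.of fun i j => ∫ s in a..b, bridge w a s b i * bridge w a s b j

theorem limitNormalizer_eq (w : ℝ → Fin d → ℝ) (a u b : ℝ) :
    limitNormalizer w a u b = ((b - a) ^ 2)⁻¹ • (bridgeGram w a u + bridgeGram w u b) := by
  ext i j
  simp [limitNormalizer, bridgeGram]

theorem tendsto_bridgeGram {ι : Type*} {l : Filter ι} {F : ι → ℝ → Fin d → ℝ}
    {w : ℝ → Fin d → ℝ} (hw : Continuous w) (hFc : ∀ i, Continuous (F i))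
    (hF : TendstoUniformly F w l) {a b : ι → ℝ} {α β : ℝ} (hlt : α < β)
    (ha : Tendsto a l (𝓝 α)) (hb : Tendsto b l (𝓝 β)) :
    Tendsto (fun x => bridgeGram (F x) (a x) (b x)) l (𝓝 (bridgeGram w α β)) := by
  refine tendsto_pi_nhds.2 fun i => tendsto_pi_nhds.2 fun j => ?_
  refine tendsto_intervalIntegral_of_ultrafilter
    (G := fun x s => bridge (F x) (a x) s (b x) i * bridge (F x) (a x) s (b x) j)
    (g := fun s => bridge w α s β i * bridge w α s β j) ?_ ?_ ha hb hlt.le ?_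
  · have := continuous_bridge hw α β
    fun_prop
  · intro x
    have := continuous_bridge (hFc x) (a x) (b x)
    fun_prop
  · intro U hU s hs
    have h := tendsto_bridge hw (hF.comp_index hU) hlt.ne (ha.comp hU) hs (hb.comp hU)
    rw [tendsto_pi_nhds] at h
    exact (h i).mul (h j)

theorem tendsto_matrix_inv {ι : Type*} {l : Filter ι} {M : ι → Matrix (Fin d) (Fin d) ℝ}
    {A : Matrix (Fin d) (Fin d) ℝ} (hA : A.det ≠ 0) (hM : Tendsto M l (𝓝 A)) :
    Tendsto (fun i => (M i)⁻¹) l (𝓝 A⁻¹) := by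
  simp only [Matrix.inv_def, Ring.inverse_eq_inv']
  have h1 : Tendsto (fun i => (M i).det) l (𝓝 A.det) :=
    ((continuous_id.matrix_det).tendsto A).comp hM
  have h2 : Tendsto (fun i => (M i).adjugate) l (𝓝 A.adjugate) :=
    ((continuous_id.matrix_adjugate).tendsto A).comp hM
  exact (h1.inv₀ hA).smul h2

/-- The quadratic form `vᵀ M⁻¹ v`. -/
def invForm (M : Matrix (Fin d) (Fin d) ℝ) (v : Fin d → ℝ) : ℝ := v ⬝ᵥ (M⁻¹ *ᵥ v)

theorem tendsto_invForm {ι : Type*} {l : Filter ι} {M : ι → Matrix (Fin d) (Fin d) ℝ}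
    {A : Matrix (Fin d) (Fin d) ℝ} (hA : A.det ≠ 0) (hM : Tendsto M l (𝓝 A)) {v : ι → Fin d → ℝ}
    {z : Fin d → ℝ} (hv : Tendsto v l (𝓝 z)) :
    Tendsto (fun i => invForm (M i) (v i)) l (𝓝 (invForm A z)) := by
  have hc : Continuous fun q : Matrix (Fin d) (Fin d) ℝ × (Fin d → ℝ) => q.2 ⬝ᵥ (q.1 *ᵥ q.2) := by
    fun_prop
  exact (hc.tendsto (A⁻¹, z)).comp ((tendsto_matrix_inv hA hM).prodMk_nhds hv)

theorem limitStat_eq (w : ℝ → Fin d → ℝ) (a u b : ℝ) :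
    limitStat w a u b = invForm (limitNormalizer w a u b) (limitContrast w a u b) := rfl

theorem tendsto_limitContrast {κ : Type*} {L : Filter κ} {F : κ → ℝ → Fin d → ℝ}
    {w : ℝ → Fin d → ℝ} (hw : Continuous w) (hF : TendstoUniformly F w L) {a s b : κ → ℝ}
    {α σ β : ℝ} (hlt : α < β) (ha : Tendsto a L (𝓝 α)) (hs : Tendsto s L (𝓝 σ))
    (hb : Tendsto b L (𝓝 β)) :
    Tendsto (fun x => limitContrast (F x) (a x) (s x) (b x)) L (𝓝 (limitContrast w α σ β)) :=
  ((hb.sub ha).sqrt.inv₀ (Real.sqrt_pos.2 (sub_pos.2 hlt)).ne').smul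
    (tendsto_bridge hw hF hlt.ne ha hs hb)

theorem tendsto_limitStat {ι : Type*} {l : Filter ι} {F : ι → ℝ → Fin d → ℝ}
    {w : ℝ → Fin d → ℝ} (hw : Continuous w) (hFc : ∀ i, Continuous (F i))
    (hF : TendstoUniformly F w l) {a u b : ι → ℝ} {α μ β : ℝ} (hlt : α < μ) (hlt' : μ < β)
    (hdet : (limitNormalizer w α μ β).det ≠ 0)
    (ha : Tendsto a l (𝓝 α)) (hu : Tendsto u l (𝓝 μ)) (hb : Tendsto b l (𝓝 β)) :
    Tendsto (fun x => limitStat (F x) (a x) (u x) (b x)) l (𝓝 (limitStat w α μ β)) := by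
  refine tendsto_invForm hdet ?_ (tendsto_limitContrast hw hF (hlt.trans hlt') ha hu hb)
  simp only [limitNormalizer_eq]
  exact (((hb.sub ha).pow 2).inv₀ (pow_pos (sub_pos.2 (hlt.trans hlt')) 2).ne').smul
    ((tendsto_bridgeGram hw hFc hF hlt ha hu).add (tendsto_bridgeGram hw hFc hF hlt' hu hb))

end

section

/-! ### Maxima over finite sets -/

theorem le_finMax {α : Type*} {S : Finset α} {f : α → ℝ} {a : α} (ha : a ∈ S) :
    f a ≤ finMax S f := by
  rw [finMax, dif_pos ⟨a, ha⟩]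
  exact Finset.le_sup' f ha

theorem exists_eq_finMax {α : Type*} {S : Finset α} (hS : S.Nonempty) (f : α → ℝ) :
    ∃ a ∈ S, finMax S f = f a := by
  rw [finMax, dif_pos hS]
  exact Finset.exists_mem_eq_sup' hS f

/-- Positivity of `c` rules out the empty set, whose maximum is `0` by convention. -/
theorem exists_le_of_le_finMax {α : Type*} {S : Finset α} {f : α → ℝ} {c : ℝ} (hc : 0 < c)
    (h : c ≤ finMax S f) : ∃ a ∈ S, c ≤ f a := by
  by_cases hS : S.Nonempty
  · obtain ⟨a, ha, e⟩ := exists_eq_finMax hS f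
    exact ⟨a, ha, e ▸ h⟩
  · rw [finMax, dif_neg hS] at h
    exact absurd h hc.not_ge

/-! ### Quadratic forms -/

variable {d : ℕ}

theorem invForm_nonneg {M : Matrix (Fin d) (Fin d) ℝ} (hM : M.PosSemidef) (v : Fin d → ℝ) :
    0 ≤ invForm M v := by
  simpa [invForm] using hM.inv.dotProduct_mulVec_nonneg v

theorem dotProduct_mulVec_comm_of_isHermitian {M : Matrix (Fin d) (Fin d) ℝ}
    (hM : M.IsHermitian) (x y : Fin d → ℝ) : x ⬝ᵥ (M *ᵥ y) = y ⬝ᵥ (M *ᵥ x) := by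
  have h : Mᵀ = M := by
    rw [← Matrix.conjTranspose_eq_transpose_of_trivial]
    exact hM.eq
  rw [Matrix.dotProduct_mulVec, ← Matrix.mulVec_transpose, h, dotProduct_comm]

/-- Inversion is antitone on positive definite matrices. With `y = A⁻¹v` and `z = (A+Q)⁻¹v`,
expanding `0 ≤ (z-y)ᵀA(z-y)` gives `2 zᵀv ≤ zᵀAz + yᵀv`, and `zᵀAz ≤ zᵀ(A+Q)z = zᵀv`. -/
theorem invForm_add_le {A Q : Matrix (Fin d) (Fin d) ℝ} (hA : A.PosDef) (hQ : Q.PosSemidef)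
    (v : Fin d → ℝ) : invForm (A + Q) v ≤ invForm A v := by
  have hB : (A + Q).PosDef := hA.add_posSemidef hQ
  set z := (A + Q)⁻¹ *ᵥ v with hz
  set y := A⁻¹ *ᵥ v with hy
  have hAy : A *ᵥ y = v := by
    rw [hy, Matrix.mulVec_mulVec, Matrix.mul_nonsing_inv _ ((Matrix.isUnit_iff_isUnit_det _).1 hA.isUnit),
      Matrix.one_mulVec]
  have hBz : (A + Q) *ᵥ z = v := by
    rw [hz, Matrix.mulVec_mulVec, Matrix.mul_nonsing_inv _ ((Matrix.isUnit_iff_isUnit_det _).1 hB.isUnit),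
      Matrix.one_mulVec]
  have h1 : 0 ≤ (z - y) ⬝ᵥ (A *ᵥ (z - y)) := by
    simpa using hA.posSemidef.dotProduct_mulVec_nonneg (z - y)
  have h2 : 0 ≤ z ⬝ᵥ (Q *ᵥ z) := by simpa using hQ.dotProduct_mulVec_nonneg z
  have h3 : z ⬝ᵥ v = z ⬝ᵥ (A *ᵥ z) + z ⬝ᵥ (Q *ᵥ z) := by
    rw [← hBz, Matrix.add_mulVec, dotProduct_add]
  have h4 : y ⬝ᵥ (A *ᵥ z) = z ⬝ᵥ v := by
    rw [dotProduct_mulVec_comm_of_isHermitian hA.isHermitian, hAy]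
  rw [Matrix.mulVec_sub, dotProduct_sub, sub_dotProduct, sub_dotProduct, h4, hAy] at h1
  change v ⬝ᵥ z ≤ v ⬝ᵥ y
  rw [dotProduct_comm v z, dotProduct_comm v y]
  linarith

/-! ### The limiting normalizer as a quadratic form -/

theorem dotProduct_bridgeGram {w : ℝ → Fin d → ℝ} (hw : Continuous w) (a b : ℝ) (v : Fin d → ℝ) :
    v ⬝ᵥ (bridgeGram w a b *ᵥ v) = ∫ s in a..b, (v ⬝ᵥ bridge w a s b) ^ 2 := by
  have hc := continuous_bridge hw a b
  have hint : ∀ i j, IntervalIntegrable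
      (fun s => v i * (bridge w a s b i * bridge w a s b j * v j)) volume a b := fun i j =>
    Continuous.intervalIntegrable (by fun_prop) _ _
  have h1 : ∀ s, (v ⬝ᵥ bridge w a s b) ^ 2 =
      ∑ i, ∑ j, v i * (bridge w a s b i * bridge w a s b j * v j) := by
    intro s
    rw [dotProduct, sq, Finset.sum_mul_sum]
    exact Finset.sum_congr rfl fun i _ => Finset.sum_congr rfl fun j _ => by ring
  simp_rw [h1]
  rw [intervalIntegral.integral_finsetSum fun i _ =>
    Continuous.intervalIntegrable (by fun_prop) _ _]
  rw [dotProduct]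
  refine Finset.sum_congr rfl fun i _ => ?_
  rw [intervalIntegral.integral_finsetSum fun j _ => hint i j, Matrix.mulVec, dotProduct,
    Finset.mul_sum]
  refine Finset.sum_congr rfl fun j _ => ?_
  rw [intervalIntegral.integral_const_mul, intervalIntegral.integral_mul_const]
  rfl

theorem isHermitian_bridgeGram (w : ℝ → Fin d → ℝ) (a b : ℝ) :
    (bridgeGram w a b).IsHermitian := by
  ext i j
  simp [bridgeGram, mul_comm]

theorem posSemidef_bridgeGram {w : ℝ → Fin d → ℝ} (hw : Continuous w) {a b : ℝ} (hab : a ≤ b) :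
    (bridgeGram w a b).PosSemidef := by
  refine Matrix.PosSemidef.of_dotProduct_mulVec_nonneg (isHermitian_bridgeGram w a b) fun v => ?_
  rw [star_trivial, dotProduct_bridgeGram hw]
  exact intervalIntegral.integral_nonneg hab fun s _ => sq_nonneg _

theorem posSemidef_limitNormalizer {w : ℝ → Fin d → ℝ} (hw : Continuous w) {a u b : ℝ}
    (hau : a ≤ u) (hub : u ≤ b) : (limitNormalizer w a u b).PosSemidef := by
  rw [limitNormalizer_eq]
  exact ((posSemidef_bridgeGram hw hau).add (posSemidef_bridgeGram hw hub)).smul (by positivity)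

/-- The left integral alone is positive definite, since a continuous nonnegative integrand that is
somewhere positive has positive integral; the right one only has to be positive semidefinite. -/
theorem posDef_limitNormalizer {w : ℝ → Fin d → ℝ} (hw : Continuous w) {a u b : ℝ}
    (hau : a < u) (hub : u ≤ b)
    (h : ∀ v : Fin d → ℝ, v ≠ 0 → ∃ s ∈ Set.Icc a u, v ⬝ᵥ bridge w a s u ≠ 0) :
    (limitNormalizer w a u b).PosDef := by
  rw [limitNormalizer_eq]
  have h1 : (bridgeGram w a u).PosDef := by
    refine Matrix.PosDef.of_dotProduct_mulVec_pos (isHermitian_bridgeGram w a u) fun v hv => ?_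
    rw [star_trivial, dotProduct_bridgeGram hw]
    obtain ⟨s, hs, hne⟩ := h v hv
    have hc := continuous_bridge hw a u
    refine intervalIntegral.integral_pos hau ?_ (fun s _ => sq_nonneg _) ⟨s, hs, by positivity⟩
    exact Continuous.continuousOn (by fun_prop)
  refine (h1.add_posSemidef (posSemidef_bridgeGram hw hub)).smul ?_
  have : 0 < b - a := by linarith
  positivity

/-! ### The window parameters of the limit -/

/-- `(u - i ε, u + j ε)` is one of the windows of `H_ε(u)`. -/
structure IsWindow (ε : ℝ) (i j : ℕ) (u : ℝ) : Prop where
  one_le_left : 1 ≤ i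
  one_le_right : 1 ≤ j
  left_le : i * ε ≤ u
  right_le : u + j * ε ≤ 1

/-- The limiting statistic at the window `(u - i ε, u + j ε)`. -/
def windowStat (w : ℝ → Fin d → ℝ) (ε : ℝ) (i j : ℕ) (u : ℝ) : ℝ :=
  limitStat w (u - i * ε) u (u + j * ε)

/-- The values over which the limiting supremum is taken. -/
def windowValues (w : ℝ → Fin d → ℝ) (ε : ℝ) : Set ℝ :=
  {v | ∃ i j u, IsWindow ε i j u ∧ windowStat w ε i j u = v}

/-- Continuous paths at which all the limiting normalizers are invertible. -/
structure IsRegular (w : ℝ → Fin d → ℝ) (ε : ℝ) : Prop where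
  continuous : Continuous w
  det_ne_zero : ∀ i j u, IsWindow ε i j u →
    (limitNormalizer w (u - i * ε) u (u + j * ε)).det ≠ 0

section Windows

variable {ε : ℝ} {i j : ℕ} {u : ℝ}

theorem IsWindow.left_pos (h : IsWindow ε i j u) (hε : 0 < ε) : ε ≤ i * ε := by
  have : (1 : ℝ) ≤ i := by exact_mod_cast h.one_le_left
  nlinarith

theorem IsWindow.right_pos (h : IsWindow ε i j u) (hε : 0 < ε) : ε ≤ j * ε := by
  have : (1 : ℝ) ≤ j := by exact_mod_cast h.one_le_right
  nlinarith

theorem IsWindow.mem_Icc (h : IsWindow ε i j u) (hε : 0 < ε) : u ∈ Set.Icc ε (1 - ε) :=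
  ⟨(h.left_pos hε).trans h.left_le, by linarith [h.right_pos hε, h.right_le]⟩

theorem mem_limitWindows (hε : 0 < ε) {q : ℝ × ℝ} :
    q ∈ limitWindows ε u ↔ ∃ i j : ℕ, IsWindow ε i j u ∧ q = (u - i * ε, u + j * ε) := by
  simp only [limitWindows, Finset.mem_image, Finset.mem_product, Finset.mem_Icc, Prod.exists]
  refine exists_congr fun i => exists_congr fun j => ⟨?_, ?_⟩
  · rintro ⟨⟨⟨h1, h2⟩, h3, h4⟩, rfl⟩
    rw [Nat.le_floor_iff' (by omega), le_div_iff₀ hε] at h2 h4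
    exact ⟨⟨h1, h3, h2, by linarith⟩, rfl⟩
  · rintro ⟨h, rfl⟩
    have h1 := h.one_le_left
    have h2 := h.one_le_right
    refine ⟨⟨⟨h1, ?_⟩, h2, ?_⟩, rfl⟩
    · rw [Nat.le_floor_iff' (by omega), le_div_iff₀ hε]
      exact h.left_le
    · rw [Nat.le_floor_iff' (by omega), le_div_iff₀ hε]
      linarith [h.right_le]

theorem isWindow_one_one (hu : u ∈ Set.Icc ε (1 - ε)) : IsWindow ε 1 1 u :=
  ⟨le_rfl, le_rfl, by simpa using hu.1, by simp only [Nat.cast_one, one_mul]; linarith [hu.2]⟩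

theorem limitWindows_nonempty (hε : 0 < ε) (hu : u ∈ Set.Icc ε (1 - ε)) :
    (limitWindows ε u).Nonempty :=
  ⟨_, (mem_limitWindows hε).2 ⟨1, 1, isWindow_one_one hu, rfl⟩⟩

variable {w : ℝ → Fin d → ℝ}

theorem windowStat_le_limitMax (hε : 0 < ε) (h : IsWindow ε i j u) :
    windowStat w ε i j u ≤ limitMax w ε u :=
  le_finMax (f := fun q : ℝ × ℝ => limitStat w q.1 u q.2) ((mem_limitWindows hε).2 ⟨i, j, h, rfl⟩)

theorem exists_limitMax_eq (hε : 0 < ε) (hu : u ∈ Set.Icc ε (1 - ε)) :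
    ∃ i j, IsWindow ε i j u ∧ limitMax w ε u = windowStat w ε i j u := by
  obtain ⟨q, hq, e⟩ := exists_eq_finMax (limitWindows_nonempty hε hu)
    fun q => limitStat w q.1 u q.2
  obtain ⟨i, j, h, rfl⟩ := (mem_limitWindows hε).1 hq
  exact ⟨i, j, h, e⟩

theorem windowStat_nonneg (hw : Continuous w) (hε : 0 < ε) (h : IsWindow ε i j u) :
    0 ≤ windowStat w ε i j u :=
  invForm_nonneg (posSemidef_limitNormalizer hw (by linarith [h.left_pos hε])
    (by linarith [h.right_pos hε])) _

theorem IsRegular.tendsto_windowStat {ι : Type*} {l : Filter ι} {F : ι → ℝ → Fin d → ℝ}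
    (hw : IsRegular w ε) (hε : 0 < ε) (hFc : ∀ x, Continuous (F x)) (hF : TendstoUniformly F w l)
    (h : IsWindow ε i j u) {z : ι → ℝ} (hz : Tendsto z l (𝓝 u)) :
    Tendsto (fun x => windowStat (F x) ε i j (z x)) l (𝓝 (windowStat w ε i j u)) :=
  tendsto_limitStat hw.continuous hFc hF (by linarith [h.left_pos hε])
    (by linarith [h.right_pos hε]) (hw.det_ne_zero i j u h) (hz.sub_const _) hz (hz.add_const _)

theorem IsRegular.continuousOn_windowStat (hw : IsRegular w ε) (hε : 0 < ε) (hi : 1 ≤ i)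
    (hj : 1 ≤ j) : ContinuousOn (windowStat w ε i j) (Set.Icc (i * ε) (1 - j * ε)) := by
  intro u hu
  refine hw.tendsto_windowStat hε (F := fun _ => w) (z := id) (fun _ => hw.continuous) ?_
    ⟨hi, hj, hu.1, by linarith [hu.2]⟩ (tendsto_id.mono_left nhdsWithin_le_nhds)
  exact fun v hv => Eventually.of_forall fun _ _ => refl_mem_uniformity hv

theorem IsWindow.left_lt (h : IsWindow ε i j u) (hε : 0 < ε) : i < ⌊1 / ε⌋₊ + 1 := by
  rw [Nat.lt_add_one_iff, Nat.le_floor_iff (by positivity), le_div_iff₀ hε]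
  linarith [h.left_le, h.right_le, h.right_pos hε]

theorem IsWindow.right_lt (h : IsWindow ε i j u) (hε : 0 < ε) : j < ⌊1 / ε⌋₊ + 1 := by
  rw [Nat.lt_add_one_iff, Nat.le_floor_iff (by positivity), le_div_iff₀ hε]
  linarith [h.left_le, h.right_le, h.left_pos hε]

theorem IsRegular.bddAbove_windowValues (hw : IsRegular w ε) (hε : 0 < ε) :
    BddAbove (windowValues w ε) := by
  set J := Finset.Icc 1 (⌊1 / ε⌋₊ + 1)
  have h : BddAbove (⋃ q ∈ ((J ×ˢ J : Finset (ℕ × ℕ)) : Set (ℕ × ℕ)), windowStat w ε q.1 q.2 ''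
      Set.Icc (q.1 * ε) (1 - q.2 * ε)) := by
    rw [Set.Finite.bddAbove_biUnion (Finset.finite_toSet (J ×ˢ J))]
    intro q hq
    have hq' : q ∈ J ×ˢ J := hq
    rw [Finset.mem_product, Finset.mem_Icc, Finset.mem_Icc] at hq'
    exact (isCompact_Icc.image_of_continuousOn
      (hw.continuousOn_windowStat hε hq'.1.1 hq'.2.1)).bddAbove
  refine h.mono ?_
  rintro _ ⟨i, j, u, hu, rfl⟩
  simp only [Set.mem_iUnion]
  refine ⟨(i, j), ?_, u, ⟨hu.left_le, by linarith [hu.right_le]⟩, rfl⟩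
  exact Finset.mem_product.2 ⟨Finset.mem_Icc.2 ⟨hu.one_le_left, (hu.left_lt hε).le⟩,
    Finset.mem_Icc.2 ⟨hu.one_le_right, (hu.right_lt hε).le⟩⟩

theorem limitMax_image_subset (hε : 0 < ε) :
    limitMax w ε '' Set.Icc ε (1 - ε) ⊆ windowValues w ε := by
  rintro _ ⟨u, hu, rfl⟩
  obtain ⟨i, j, h, e⟩ := exists_limitMax_eq (w := w) hε hu
  exact ⟨i, j, u, h, e.symm⟩

theorem bddAbove_range_limitMax (hw : IsRegular w ε) (hε : 0 < ε) {U : Set ℝ}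
    (hU : U ⊆ Set.Icc ε (1 - ε)) : BddAbove (Set.range fun u : U => limitMax w ε u) := by
  refine (hw.bddAbove_windowValues hε).mono ?_
  rintro _ ⟨u, rfl⟩
  exact limitMax_image_subset hε ⟨u, hU u.2, rfl⟩

/-- Replaces the nested supremum and maximum, whose default values must be kept out, by a least
upper bound over all windows at once. -/
theorem IsRegular.isLUB_limitSup (hw : IsRegular w ε) (hε : 0 < ε) (hε' : ε < 1 / 2) :
    IsLUB (windowValues w ε) (limitSup w ε (Set.Icc ε (1 - ε))) := by
  have hne : Nonempty (Set.Icc ε (1 - ε)) := ⟨⟨ε, le_rfl, by linarith⟩⟩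
  constructor
  · rintro _ ⟨i, j, u, h, rfl⟩
    exact (windowStat_le_limitMax hε h).trans
      (le_ciSup (bddAbove_range_limitMax hw hε subset_rfl) ⟨u, h.mem_Icc hε⟩)
  · intro c hc
    exact ciSup_le fun u => hc (limitMax_image_subset hε ⟨u, u.2, rfl⟩)

/-- The admissible positions for `(i, j)` form `[iε, 1 - jε]`. As `(i+j)ε ≠ 1`, a nonempty such
interval is the closure of its interior, which lies in `(ε, 1-ε)`, and continuity in `u` carries the
bound to the endpoints. If `(i+j)ε = 1`, the interval is a single point. -/
theorem IsRegular.limitSup_Ioo (hw : IsRegular w ε) (hε : 0 < ε) (hε' : ε < 1 / 2)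
    (hint : ∀ m : ℕ, (m : ℝ) * ε ≠ 1) :
    limitSup w ε (Set.Ioo ε (1 - ε)) = limitSup w ε (Set.Icc ε (1 - ε)) := by
  have hne : Nonempty (Set.Ioo ε (1 - ε)) := ⟨⟨1 / 2, hε', by linarith⟩⟩
  have hlub := hw.isLUB_limitSup hε hε'
  have hbdd := bddAbove_range_limitMax hw hε (Set.Ioo_subset_Icc_self (a := ε) (b := 1 - ε))
  apply le_antisymm
  · refine ciSup_le fun u => hlub.1 (limitMax_image_subset hε ⟨u, Set.Ioo_subset_Icc_self u.2, rfl⟩)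
  · refine hlub.2 ?_
    rintro _ ⟨i, j, u, h, rfl⟩
    have hlt : (i : ℝ) * ε < 1 - j * ε := by
      refine lt_of_le_of_ne (by linarith [h.left_le, h.right_le]) fun e => hint (i + j) ?_
      push_cast
      linarith
    have hcl : u ∈ closure (Set.Ioo ((i : ℝ) * ε) (1 - j * ε)) := by
      rw [closure_Ioo hlt.ne]
      exact ⟨h.left_le, by linarith [h.right_le]⟩
    have hc := hw.continuousOn_windowStat hε h.one_le_left h.one_le_right
    rw [← closure_Ioo hlt.ne] at hc
    refine ContinuousWithinAt.closure_le hcl ((hc u hcl).mono subset_closure)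
      continuousWithinAt_const fun z hz => ?_
    have hz' : IsWindow ε i j z := ⟨h.one_le_left, h.one_le_right, hz.1.le, by linarith [hz.2]⟩
    have hzI : z ∈ Set.Ioo ε (1 - ε) :=
      ⟨(h.left_pos hε).trans_lt hz.1, by linarith [hz.2, h.right_pos hε]⟩
    exact (windowStat_le_limitMax hε hz').trans (le_ciSup hbdd ⟨z, hzI⟩)

/-- A sequence converges to the limiting supremum if it asymptotically dominates every window
value and its large values are asymptotically dominated by window values. -/
theorem IsRegular.tendsto_limitSup {ι : Type*} {l : Filter ι} {Z : ι → ℝ} (hw : IsRegular w ε)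
    (hε : 0 < ε) (hε' : ε < 1 / 2)
    (upper : ∀ U : Ultrafilter ι, ↑U ≤ l → ∀ c c', 0 < c → c < c' → (∀ᶠ x in U, c' ≤ Z x) →
      ∃ v ∈ windowValues w ε, c ≤ v)
    (lower : ∀ i j u, IsWindow ε i j u → ∀ c < windowStat w ε i j u, ∀ᶠ x in l, c < Z x) :
    Tendsto Z l (𝓝 (limitSup w ε (Set.Icc ε (1 - ε)))) := by
  have hlub := hw.isLUB_limitSup hε hε'
  -- Nonnegativity makes every level above the limit positive, as `upper` requires.
  have h0 : 0 ≤ limitSup w ε (Set.Icc ε (1 - ε)) := by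
    have h : IsWindow ε 1 1 ε := isWindow_one_one ⟨le_rfl, by linarith⟩
    exact (windowStat_nonneg hw.continuous hε h).trans (hlub.1 ⟨1, 1, ε, h, rfl⟩)
  refine tendsto_order.2 ⟨fun c hc => ?_, fun c hc => ?_⟩
  · obtain ⟨_, ⟨i, j, u, h, rfl⟩, hv⟩ := (lt_isLUB_iff hlub).1 hc
    exact lower i j u h c hv
  -- If `Z` is not eventually below `c`, some ultrafilter finer than `l` lives on the set where `c ≤
  -- Z`.
  · by_contra hcon
    rw [not_eventually] at hcon
    obtain ⟨U, hU⟩ := Filter.exists_ultrafilter_iff.2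
      (frequently_mem_iff_neBot (s := {x | ¬Z x < c}).1 hcon)
    obtain ⟨c₁, h1, h2⟩ := exists_between hc
    obtain ⟨v, hv, hcv⟩ := upper U (hU.trans inf_le_left) c₁ c (h0.trans_lt h1) h2
      ((hU.trans inf_le_right) (mem_principal.2 fun x hx => not_lt.1 hx))
    exact absurd (hlub.1 hv) (by linarith)

/-- Along an ultrafilter, bounded natural numbers are eventually constant. -/
theorem exists_eventually_eq_of_lt {ι : Type*} (U : Ultrafilter ι) {M : ℕ} {f : ι → ℕ}
    (hf : ∀ᶠ x in U, f x < M) : ∃ m, ∀ᶠ x in U, f x = m := by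
  have h : ∀ᶠ x in U, ∃ m ∈ Set.Iio M, f x = m := hf.mono fun x hx => ⟨f x, hx, rfl⟩
  obtain ⟨m, -, hm⟩ := (Ultrafilter.eventually_exists_mem_iff (Set.finite_Iio M)).1 h
  exact ⟨m, hm⟩

theorem exists_tendsto_of_mem_Icc {ι : Type*} (U : Ultrafilter ι) {f : ι → ℝ}
    (hf : ∀ᶠ x in U, f x ∈ Set.Icc (0 : ℝ) 1) : ∃ u, Tendsto f U (𝓝 u) := by
  obtain ⟨s, -, hs⟩ := isCompact_Icc.ultrafilter_le_nhds' (U.map f) hf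
  exact ⟨s, hs⟩

/-- Choose nearly maximizing windows of the approximating paths. Along an ultrafilter their `i` and
`j` are constant and `u` converges; the window inequalities are closed, so the limit is again a
window. -/
theorem IsRegular.tendsto_limitSup_of_tendstoUniformly {ι : Type*} {l : Filter ι}
    {F : ι → ℝ → Fin d → ℝ} (hw : IsRegular w ε) (hε : 0 < ε) (hε' : ε < 1 / 2)
    (hreg : ∀ x, IsRegular (F x) ε) (hF : TendstoUniformly F w l) :
    Tendsto (fun x => limitSup (F x) ε (Set.Icc ε (1 - ε))) l
      (𝓝 (limitSup w ε (Set.Icc ε (1 - ε)))) := by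
  refine hw.tendsto_limitSup hε hε' ?_ ?_
  · intro U hU c c' _ hcc hZ
    have h : ∀ x, ∃ i j u, IsWindow ε i j u ∧
        (c' ≤ limitSup (F x) ε (Set.Icc ε (1 - ε)) → c < windowStat (F x) ε i j u) := by
      intro x
      by_cases hx : c' ≤ limitSup (F x) ε (Set.Icc ε (1 - ε))
      · obtain ⟨_, ⟨i, j, u, h, rfl⟩, hv⟩ :=
          (lt_isLUB_iff ((hreg x).isLUB_limitSup hε hε')).1 (hcc.trans_le hx)
        exact ⟨i, j, u, h, fun _ => hv⟩
      -- An arbitrary window, to make the choice total.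
      · exact ⟨1, 1, ε, isWindow_one_one ⟨le_rfl, by linarith⟩, fun h => absurd h hx⟩
    choose i j u hwin hval using h
    obtain ⟨i₀, hi⟩ := exists_eventually_eq_of_lt U
      (Eventually.of_forall fun x => (hwin x).left_lt hε)
    obtain ⟨j₀, hj⟩ := exists_eventually_eq_of_lt U
      (Eventually.of_forall fun x => (hwin x).right_lt hε)
    obtain ⟨u₀, hu⟩ := exists_tendsto_of_mem_Icc U (f := u) (Eventually.of_forall fun x =>
      ⟨hε.le.trans ((hwin x).mem_Icc hε).1, ((hwin x).mem_Icc hε).2.trans (by linarith)⟩)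
    have hev : ∀ᶠ x in (U : Filter ι), IsWindow ε i₀ j₀ (u x) := by
      filter_upwards [hi, hj] with x h1 h2
      rw [← h1, ← h2]
      exact hwin x
    have hw₀ : IsWindow ε i₀ j₀ u₀ := by
      obtain ⟨x, hx⟩ := hev.exists
      exact ⟨hx.one_le_left, hx.one_le_right, ge_of_tendsto hu (hev.mono fun x hx => hx.left_le),
        le_of_tendsto (hu.add_const _) (hev.mono fun x hx => hx.right_le)⟩
    refine ⟨_, ⟨i₀, j₀, u₀, hw₀, rfl⟩, ?_⟩
    refine ge_of_tendsto (hw.tendsto_windowStat hε (fun x => (hreg x).continuous)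
      (hF.comp_index (j := id) hU) hw₀ hu) ?_
    filter_upwards [hi, hj, hZ] with x h1 h2 h3
    rw [← h1, ← h2]
    exact (hval x h3).le
  · intro i j u h c hc
    filter_upwards [(hw.tendsto_windowStat hε (fun x => (hreg x).continuous) hF h
      tendsto_const_nhds).eventually (lt_mem_nhds hc)] with x hx
    exact hx.trans_le (((hreg x).isLUB_limitSup hε hε').1 ⟨i, j, u, h, rfl⟩)

end Windows

end

section

variable {p d : ℕ}

/-- An element of `D([0,1], ℝ^d)` as a path on the real line, constant outside `[0,1]`. -/
def pathFun (x : DSpace d) : ℝ → Fin d → ℝ :=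
  fun s => (x.toFun (Set.projIcc 0 1 zero_le_one s)).ofLp

/-! ### Exact expression of the statistic through partial sums and remainders -/

section Algebra

variable (θ : Measure (EuclideanSpace ℝ (Fin p)) → EuclideanSpace ℝ (Fin d))
  (θ₀ : EuclideanSpace ℝ (Fin d)) (ξ : EuclideanSpace ℝ (Fin p) → EuclideanSpace ℝ (Fin d))
  (y : ℕ → EuclideanSpace ℝ (Fin p))

/-- The normalized difference of the estimators on the blocks `(a, m]` and `(m, b]`. -/
def blockDiff (a m b : ℕ) : EuclideanSpace ℝ (Fin d) :=
  (((m : ℝ) - a) * ((b : ℝ) - m) / ((b : ℝ) - a)) •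
    (thetaHat θ y (a + 1) m - thetaHat θ y (m + 1) b)

/-- The contribution of the remainders to `blockDiff`. -/
def blockRemainder (a m b : ℕ) : EuclideanSpace ℝ (Fin d) :=
  (((m : ℝ) - a) * ((b : ℝ) - m) / ((b : ℝ) - a)) •
    (remainder θ θ₀ ξ y (a + 1) m - remainder θ θ₀ ξ y (m + 1) b)

/-- `blockDiff` divided by `√n`. -/
def scaledDiff (n a m b : ℕ) : EuclideanSpace ℝ (Fin d) := (√(n : ℝ))⁻¹ • blockDiff θ y a m b

/-- The averaged outer products of the scaled block differences over split points in `I`. -/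
def scaledGram (n a b : ℕ) (I : Finset ℕ) : Matrix (Fin d) (Fin d) ℝ :=
  (n : ℝ)⁻¹ • ∑ m ∈ I, outer (scaledDiff θ y n a m b)

variable {θ θ₀ ξ y}

theorem outer_smul (c : ℝ) (v : EuclideanSpace ℝ (Fin d)) : outer (c • v) = c ^ 2 • outer v := by
  ext i j
  simp [outer, Matrix.vecMulVec_apply]
  ring

theorem outer_neg (v : EuclideanSpace ℝ (Fin d)) : outer (-v) = outer v := by
  ext i j
  simp [outer, Matrix.vecMulVec_apply]

theorem posSemidef_outer (v : EuclideanSpace ℝ (Fin d)) : (outer v).PosSemidef := by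
  simpa [outer] using Matrix.posSemidef_vecMulVec_self_star v.ofLp

theorem posSemidef_scaledGram (n a b : ℕ) (I : Finset ℕ) :
    (scaledGram θ y n a b I).PosSemidef :=
  (Matrix.posSemidef_sum I fun _ _ => posSemidef_outer _).smul (by positivity)

theorem scaledGram_sdiff {n a b : ℕ} {I J : Finset ℕ} (h : I ⊆ J) :
    scaledGram θ y n a b J = scaledGram θ y n a b I + scaledGram θ y n a b (J \ I) := by
  rw [scaledGram, scaledGram, scaledGram, ← smul_add, add_comm, Finset.sum_sdiff h]

theorem pathFun_partialSumPath {n m : ℕ} (hn : 0 < n) (hm : m ≤ n) :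
    pathFun (partialSumPath ξ n y) ((m : ℝ) / n) =
      ((√(n : ℝ))⁻¹ • ∑ t ∈ Finset.Icc 1 m, ξ (y t)).ofLp := by
  have hn' : (0 : ℝ) < n := by exact_mod_cast hn
  have hm' : (m : ℝ) ≤ n := by exact_mod_cast hm
  have h1 : (m : ℝ) / n ∈ Set.Icc (0 : ℝ) 1 := ⟨by positivity, by rwa [div_le_one hn']⟩
  have h2 : (n : ℝ) * ((m : ℝ) / n) = m := by field_simp
  simp only [pathFun, partialSumPath, Set.projIcc_of_mem zero_le_one h1, h2, Nat.floor_natCast]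

theorem sum_Icc_succ_eq_sub {E : Type*} [AddCommGroup E] (f : ℕ → E) {a b : ℕ} (hab : a ≤ b) :
    ∑ t ∈ Finset.Icc (a + 1) b, f t =
      ∑ t ∈ Finset.Icc 1 b, f t - ∑ t ∈ Finset.Icc 1 a, f t := by
  have h : ∀ a b, Finset.Icc (a + 1) b = Finset.Ioc a b := fun a b => by ext; simp
  rw [eq_sub_iff_add_eq', h a b, show 1 = 0 + 1 from rfl, h 0 a, h 0 b]
  exact Finset.sum_Ioc_consecutive f (Nat.zero_le a) hab

/-- With partial sums `A`, `M`, `B`, the weight `(m-a)(b-m)/(b-a)` turns the difference of the block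
means into `M - A - (m-a)/(b-a)·(B - A)`. -/
theorem scaledDiff_eq {n a m b : ℕ} (ham : a < m) (hmb : m < b) (hbn : b ≤ n) :
    (scaledDiff θ y n a m b).ofLp =
      bridge (pathFun (partialSumPath ξ n y)) ((a : ℝ) / n) ((m : ℝ) / n) ((b : ℝ) / n) +
        (√(n : ℝ))⁻¹ • (blockRemainder θ θ₀ ξ y a m b).ofLp := by
  have hn : 0 < n := by omega
  have hn' : (0 : ℝ) < n := by exact_mod_cast hn
  have h1 : (a : ℝ) < m := by exact_mod_cast ham
  have h2 : (m : ℝ) < b := by exact_mod_cast hmb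
  have h1' : (m : ℝ) - a ≠ 0 := (sub_pos.2 h1).ne'
  have h2' : (b : ℝ) - m ≠ 0 := (sub_pos.2 h2).ne'
  have h3' : (b : ℝ) - a ≠ 0 := (sub_pos.2 (h1.trans h2)).ne'
  set A := ∑ t ∈ Finset.Icc 1 a, ξ (y t) with hA
  set M := ∑ t ∈ Finset.Icc 1 m, ξ (y t) with hM
  set B := ∑ t ∈ Finset.Icc 1 b, ξ (y t) with hB
  have e1 : thetaHat θ y (a + 1) m =
      θ₀ + ((m : ℝ) - a)⁻¹ • (M - A) + remainder θ θ₀ ξ y (a + 1) m := by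
    rw [remainder, sum_Icc_succ_eq_sub _ ham.le]
    push_cast
    rw [show (m : ℝ) - (a + 1) + 1 = m - a by ring]
    abel
  have e2 : thetaHat θ y (m + 1) b =
      θ₀ + ((b : ℝ) - m)⁻¹ • (B - M) + remainder θ θ₀ ξ y (m + 1) b := by
    rw [remainder, sum_Icc_succ_eq_sub _ hmb.le]
    push_cast
    rw [show (b : ℝ) - (m + 1) + 1 = b - m by ring]
    abel
  have e3 : ((m : ℝ) / n - (a : ℝ) / n) / ((b : ℝ) / n - (a : ℝ) / n) =
      ((m : ℝ) - a) / ((b : ℝ) - a) := by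
    rw [← sub_div, ← sub_div, div_div_div_cancel_right₀ hn'.ne']
  rw [bridge, pathFun_partialSumPath hn (by omega), pathFun_partialSumPath hn (by omega),
    pathFun_partialSumPath hn hbn, e3, scaledDiff, blockDiff, blockRemainder, e1, e2]
  ext c
  simp only [WithLp.ofLp_smul, WithLp.ofLp_sub, WithLp.ofLp_add, Pi.smul_apply, Pi.sub_apply,
    Pi.add_apply, smul_eq_mul, ← hA, ← hM, ← hB]
  field_simp
  ring

/-- The weight is at most each of the two block lengths, so each remainder is multiplied by the
length of its own block, as in `supRemainder`. -/
theorem norm_blockRemainder_le {a m b : ℕ} (ham : a < m) (hmb : m < b) :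
    ‖blockRemainder θ θ₀ ξ y a m b‖ ≤
      ((m : ℝ) - a) * ‖remainder θ θ₀ ξ y (a + 1) m‖ +
        ((b : ℝ) - m) * ‖remainder θ θ₀ ξ y (m + 1) b‖ := by
  have h1 : (0 : ℝ) < m - a := sub_pos.2 (by exact_mod_cast ham)
  have h2 : (0 : ℝ) < b - m := sub_pos.2 (by exact_mod_cast hmb)
  have h3 : (0 : ℝ) < b - a := by linarith
  rw [blockRemainder, norm_smul, Real.norm_of_nonneg (by positivity)]
  have h4 : ((m : ℝ) - a) * (b - m) / (b - a) ≤ m - a := by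
    rw [div_le_iff₀ h3]
    gcongr
  have h5 : ((m : ℝ) - a) * (b - m) / (b - a) ≤ b - m := by
    rw [div_le_iff₀ h3, mul_comm]
    gcongr
  refine (mul_le_mul_of_nonneg_left (norm_sub_le _ _) (by positivity)).trans ?_
  rw [mul_add]
  gcongr

/-- The gap of two is essential: `supRemainder` ignores blocks of one observation. -/
theorem mul_norm_remainder_le {n a b : ℕ} (hab : a + 2 ≤ b) (hb : b ≤ n) :
    ((b : ℝ) - a) * ‖remainder θ θ₀ ξ y (a + 1) b‖ ≤ supRemainder θ θ₀ ξ n y := by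
  have h := le_finMax (S := (Finset.Icc 1 n ×ˢ Finset.Icc 1 n).filter fun q => q.1 < q.2)
    (f := fun q => ((q.2 : ℝ) - q.1 + 1) * ‖remainder θ θ₀ ξ y q.1 q.2‖) (a := (a + 1, b))
    (by simp; omega)
  refine le_trans (le_of_eq ?_) h
  push_cast
  ring

theorem contrast_eq {n a k b : ℕ} (hn : 0 < n) (hak : a ≤ k) (hkb : k < b) :
    (contrast θ y (a + 1) k b).ofLp =
      (√((b : ℝ) / n - (a : ℝ) / n))⁻¹ • (scaledDiff θ y n a k b).ofLp := by
  have hn' : (0 : ℝ) < n := by exact_mod_cast hn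
  have h1 : (a : ℝ) ≤ k := by exact_mod_cast hak
  have h2 : (k : ℝ) < b := by exact_mod_cast hkb
  have h3 : (0 : ℝ) < b - a := by linarith
  suffices hs : contrast θ y (a + 1) k b =
      (√((b : ℝ) / n - (a : ℝ) / n))⁻¹ • scaledDiff θ y n a k b by
    rw [hs, WithLp.ofLp_smul]
  rw [contrast, scaledDiff, blockDiff, smul_smul, smul_smul]
  congr 1
  push_cast
  rw [show (b : ℝ) - (a + 1) + 1 = b - a by ring, show (k : ℝ) - (a + 1) + 1 = k - a by ring,
    ← sub_div, Real.sqrt_div h3.le,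
    show (3 / 2 : ℝ) = 1 + 1 / 2 by norm_num, Real.rpow_add h3, Real.rpow_one, ← Real.sqrt_eq_rpow]
  have h4 : 0 < √((b : ℝ) - a) := Real.sqrt_pos.2 h3
  have h5 : 0 < √(n : ℝ) := Real.sqrt_pos.2 hn'
  field_simp

theorem smul_outer_scaledDiff {n a m b : ℕ} (hn : 0 < n) {c : ℝ} :
    (c ^ 2)⁻¹ • outer (blockDiff θ y a m b) =
      ((c / n) ^ 2)⁻¹ • ((n : ℝ)⁻¹ • outer (scaledDiff θ y n a m b)) := by
  have hn' : (0 : ℝ) < n := by exact_mod_cast hn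
  rw [scaledDiff, outer_smul, smul_smul, smul_smul, inv_pow, Real.sq_sqrt hn'.le]
  congr 1
  field_simp

theorem leftNormalizer_eq {n a k b : ℕ} (hn : 0 < n) (hak : a < k) :
    leftNormalizer θ y (a + 1) k b =
      (((b : ℝ) / n - (a : ℝ) / n) ^ 2)⁻¹ • scaledGram θ y n a k (Finset.Ioo a k) := by
  have h1 : (a : ℝ) < k := by exact_mod_cast hak
  have h3 : (0 : ℝ) < k - a := by linarith
  -- The term `i = k` involves an estimator on an empty block, but has weight zero.
  have hI : Finset.Icc (a + 1) k = insert k (Finset.Ioo a k) := by ext; simp; omega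
  rw [leftNormalizer, hI, Finset.sum_insert (by simp), ← sub_div, scaledGram, Finset.smul_sum,
    Finset.smul_sum]
  simp only [sub_self, ne_eq, OfNat.ofNat_ne_zero, not_false_eq_true, zero_pow, mul_zero, zero_div,
    zero_smul, zero_add]
  refine Finset.sum_congr rfl fun m _ => ?_
  rw [← smul_outer_scaledDiff hn, blockDiff, outer_smul, smul_smul]
  congr 1
  push_cast
  rw [show (b : ℝ) - (a + 1) + 1 = b - a by ring, show (k : ℝ) - (a + 1) + 1 = k - a by ring,
    show (m : ℝ) - (a + 1) + 1 = m - a by ring, div_pow, mul_pow, ← div_eq_inv_mul, div_div,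
    mul_comm (((b : ℝ) - a) ^ 2)]

theorem rightNormalizer_eq {n a k b : ℕ} (hn : 0 < n) (hkb : k < b) :
    rightNormalizer θ y (a + 1) k b =
      (((b : ℝ) / n - (a : ℝ) / n) ^ 2)⁻¹ • scaledGram θ y n k b (Finset.Ioo k b) := by
  have h1 : (k : ℝ) < b := by exact_mod_cast hkb
  have h3 : (0 : ℝ) < b - k := by linarith
  -- The index `m = i - 1` is the last point of the first block, as on the left side; `m = k` has
  -- weight zero. The opposite sign of the difference does not affect the outer product.
  have hI : Finset.Icc (k + 1) b = (insert k (Finset.Ioo k b)).image fun m => m + 1 := by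
    ext t
    simp only [Finset.mem_Icc, Finset.mem_image, Finset.mem_insert, Finset.mem_Ioo]
    refine ⟨fun h => ⟨t - 1, by omega, by omega⟩, ?_⟩
    rintro ⟨m, hm, rfl⟩
    omega
  rw [rightNormalizer, hI, Finset.sum_image (by simp), Finset.sum_insert (by simp), ← sub_div,
    scaledGram, Finset.smul_sum, Finset.smul_sum]
  simp only [Nat.cast_add, Nat.cast_one, add_sub_cancel_right, sub_self, ne_eq,
    OfNat.ofNat_ne_zero, not_false_eq_true, zero_pow, mul_zero, zero_div,
    zero_smul, zero_add, Nat.add_sub_cancel]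
  refine Finset.sum_congr rfl fun m _ => ?_
  rw [← smul_outer_scaledDiff hn, blockDiff, outer_smul, smul_smul,
    ← outer_neg (thetaHat θ y (k + 1) m - _), neg_sub]
  congr 1
  rw [show (b : ℝ) - (a + 1) + 1 = b - a by ring, show (b : ℝ) - (m + 1) + 1 = b - m by ring,
    div_pow, mul_pow, ← div_eq_inv_mul, div_div,
    mul_comm (((b : ℝ) - a) ^ 2), mul_comm (((b : ℝ) - m) ^ 2)]

/-- The scale `n` is free here: asymptotics take the sample size, measurability takes `1`. Only
estimators on nonempty blocks remain. -/
theorem snStat_eq {n a k b : ℕ} (hn : 0 < n) (hak : a < k) (hkb : k < b) :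
    snStat θ y (a + 1) k b =
      invForm ((((b : ℝ) / n - (a : ℝ) / n) ^ 2)⁻¹ • (scaledGram θ y n a k (Finset.Ioo a k) +
          scaledGram θ y n k b (Finset.Ioo k b)))
        ((√((b : ℝ) / n - (a : ℝ) / n))⁻¹ • (scaledDiff θ y n a k b).ofLp) := by
  rw [snStat, contrast_eq hn hak.le hkb, normalizer, leftNormalizer_eq hn hak,
    rightNormalizer_eq hn hkb, smul_add]
  rfl

end Algebra

end

section

variable {p d : ℕ} {ι : Type*} {l : Filter ι}

/-! ### Asymptotics of the block statistics -/

/-- Along `l`, the samples `y` of sizes `n` have partial sum paths converging uniformly to `w`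
and uniformly negligible remainders. -/
structure IsApprox (θ : Measure (EuclideanSpace ℝ (Fin p)) → EuclideanSpace ℝ (Fin d))
    (θ₀ : EuclideanSpace ℝ (Fin d)) (ξ : EuclideanSpace ℝ (Fin p) → EuclideanSpace ℝ (Fin d))
    (n : ι → ℕ) (y : ι → ℕ → EuclideanSpace ℝ (Fin p)) (w : ℝ → Fin d → ℝ) (l : Filter ι) :
    Prop where
  size : Tendsto n l atTop
  path : TendstoUniformly (fun i => pathFun (partialSumPath ξ (n i) (y i))) w l
  rem : Tendsto (fun i => supRemainder θ θ₀ ξ (n i) (y i) / √(n i : ℝ)) l (𝓝 0)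

variable {θ : Measure (EuclideanSpace ℝ (Fin p)) → EuclideanSpace ℝ (Fin d)}
  {θ₀ : EuclideanSpace ℝ (Fin d)} {ξ : EuclideanSpace ℝ (Fin p) → EuclideanSpace ℝ (Fin d)}
  {n : ι → ℕ} {y : ι → ℕ → EuclideanSpace ℝ (Fin p)} {w : ℝ → Fin d → ℝ}

theorem IsApprox.comp (h : IsApprox θ θ₀ ξ n y w l) {κ : Type*} {L : Filter κ} {j : κ → ι}
    (hj : Tendsto j L l) : IsApprox θ θ₀ ξ (fun x => n (j x)) (fun x => y (j x)) w L :=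
  ⟨h.size.comp hj, h.path.comp_index hj, h.rem.comp hj⟩

theorem norm_ofLp_le (v : EuclideanSpace ℝ (Fin d)) : ‖v.ofLp‖ ≤ ‖v‖ :=
  (pi_norm_le_iff_of_nonneg (norm_nonneg v)).2 fun c => PiLp.norm_apply_le v c

theorem IsApprox.tendsto_inv_sqrt (h : IsApprox θ θ₀ ξ n y w l) :
    Tendsto (fun i => (√(n i : ℝ))⁻¹) l (𝓝 0) :=
  tendsto_inv_atTop_zero.comp
    (Real.tendsto_sqrt_atTop.comp (tendsto_natCast_atTop_atTop.comp h.size))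

theorem IsApprox.tendsto_inv (h : IsApprox θ θ₀ ξ n y w l) :
    Tendsto (fun i => (n i : ℝ)⁻¹) l (𝓝 0) :=
  tendsto_inv_atTop_zero.comp (tendsto_natCast_atTop_atTop.comp h.size)

theorem IsApprox.eventually_add_le (h : IsApprox θ θ₀ ξ n y w l) {a b : ι → ℕ} {α β : ℝ}
    (hlt : α < β) (ha : Tendsto (fun i => (a i : ℝ) / n i) l (𝓝 α))
    (hb : Tendsto (fun i => (b i : ℝ) / n i) l (𝓝 β)) (K : ℕ) : ∀ᶠ i in l, a i + K ≤ b i := by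
  have h1 : Tendsto (fun i => (a i : ℝ) / n i + K * (n i : ℝ)⁻¹) l (𝓝 α) := by
    simpa using ha.add (h.tendsto_inv.const_mul (K : ℝ))
  filter_upwards [h1.eventually_lt hb hlt, h.size.eventually_gt_atTop 0] with i hi hn
  have hn' : (0 : ℝ) < n i := by exact_mod_cast hn
  rw [← div_eq_mul_inv, ← add_div, div_lt_div_iff_of_pos_right hn'] at hi
  exact_mod_cast hi.le

variable {a m b : ι → ℕ} {α σ β : ℝ}

theorem IsApprox.tendsto_scaledDiff (h : IsApprox θ θ₀ ξ n y w l) (hw : Continuous w)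
    (hev : ∀ᶠ i in l, a i + 2 ≤ m i ∧ m i + 2 ≤ b i ∧ b i ≤ n i) (hne : α ≠ β)
    (ha : Tendsto (fun i => (a i : ℝ) / n i) l (𝓝 α))
    (hm : Tendsto (fun i => (m i : ℝ) / n i) l (𝓝 σ))
    (hb : Tendsto (fun i => (b i : ℝ) / n i) l (𝓝 β)) :
    Tendsto (fun i => (scaledDiff θ (y i) (n i) (a i) (m i) (b i)).ofLp) l
      (𝓝 (bridge w α σ β)) := by
  have h1 := tendsto_bridge hw h.path hne ha hm hb
  have h2 : Tendsto (fun i => (√(n i : ℝ))⁻¹ •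
      (blockRemainder θ θ₀ ξ (y i) (a i) (m i) (b i)).ofLp) l (𝓝 0) := by
    refine squeeze_zero_norm' ?_ (by simpa using h.rem.const_mul 2)
    filter_upwards [hev] with i hi
    rw [norm_smul, Real.norm_of_nonneg (by positivity), ← mul_div_assoc, inv_mul_eq_div]
    gcongr
    refine (norm_ofLp_le _).trans ((norm_blockRemainder_le (by omega) (by omega)).trans ?_)
    rw [two_mul]
    exact add_le_add (mul_norm_remainder_le hi.1 (by omega))
      (mul_norm_remainder_le hi.2.1 hi.2.2)
  have h3 := h1.add h2
  rw [add_zero] at h3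
  refine h3.congr' ?_
  filter_upwards [hev] with i hi
  exact (scaledDiff_eq (by omega) (by omega) hi.2.2).symm

/-- A single outer product carries a factor `1/n`, so a block remainder of order `o(n)`, rather than
`o(√n)`, is enough for it to vanish. -/
theorem IsApprox.tendsto_scaledGram_singleton (h : IsApprox θ θ₀ ξ n y w l) (hw : Continuous w)
    (hev : ∀ᶠ i in l, a i < m i ∧ m i < b i ∧ b i ≤ n i) (hne : α ≠ β)
    (ha : Tendsto (fun i => (a i : ℝ) / n i) l (𝓝 α))
    (hm : Tendsto (fun i => (m i : ℝ) / n i) l (𝓝 σ))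
    (hb : Tendsto (fun i => (b i : ℝ) / n i) l (𝓝 β))
    (hrem : Tendsto (fun i => ‖blockRemainder θ θ₀ ξ (y i) (a i) (m i) (b i)‖ / n i) l (𝓝 0)) :
    Tendsto (fun i => scaledGram θ (y i) (n i) (a i) (b i) {m i}) l (𝓝 0) := by
  have h1 := h.tendsto_inv_sqrt.smul (tendsto_bridge hw h.path hne ha hm hb)
  have h2 : Tendsto (fun i => (n i : ℝ)⁻¹ •
      (blockRemainder θ θ₀ ξ (y i) (a i) (m i) (b i)).ofLp) l (𝓝 0) := by
    refine squeeze_zero_norm (fun i => ?_) hrem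
    rw [norm_smul, Real.norm_of_nonneg (by positivity), inv_mul_eq_div]
    gcongr
    exact norm_ofLp_le _
  have h3 : Tendsto (fun i => (√(n i : ℝ))⁻¹ •
      (scaledDiff θ (y i) (n i) (a i) (m i) (b i)).ofLp) l (𝓝 0) := by
    have h4 := h1.add h2
    rw [add_zero, zero_smul] at h4
    refine h4.congr' ?_
    filter_upwards [hev] with i hi
    rw [scaledDiff_eq (θ₀ := θ₀) (ξ := ξ) hi.1 hi.2.1 hi.2.2, smul_add, smul_smul, ← mul_inv,
      Real.mul_self_sqrt (Nat.cast_nonneg _)]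
  refine tendsto_pi_nhds.2 fun c => tendsto_pi_nhds.2 fun c' => ?_
  have h4 := tendsto_pi_nhds.1 h3
  have h5 := (h4 c).mul (h4 c')
  simp only [Pi.zero_apply, mul_zero] at h5
  refine h5.congr fun i => ?_
  simp only [Pi.smul_apply, smul_eq_mul, scaledGram, Finset.sum_singleton, Matrix.smul_apply,
    outer, Matrix.vecMulVec_apply]
  rw [mul_mul_mul_comm, ← mul_inv, Real.mul_self_sqrt (Nat.cast_nonneg _)]

/-- The split points in `Ico (a+2) (b-1)` are those leaving at least two observations on either
side, so no remainder of a single observation enters. -/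
theorem IsApprox.tendsto_scaledGram_interior (h : IsApprox θ θ₀ ξ n y w l) (hw : Continuous w)
    (hbn : ∀ᶠ i in l, b i ≤ n i) (hlt : α < β)
    (ha : Tendsto (fun i => (a i : ℝ) / n i) l (𝓝 α))
    (hb : Tendsto (fun i => (b i : ℝ) / n i) l (𝓝 β)) :
    Tendsto (fun i => scaledGram θ (y i) (n i) (a i) (b i) (Finset.Ico (a i + 2) (b i - 1))) l
      (𝓝 (bridgeGram w α β)) := by
  have hab := h.eventually_add_le hlt ha hb 3
  have ha' : Tendsto (fun i => ((a i + 2 : ℕ) : ℝ) / n i) l (𝓝 α) := by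
    have := ha.add (h.tendsto_inv.const_mul 2)
    simp only [mul_zero, add_zero] at this
    refine this.congr fun i => ?_
    push_cast
    rw [add_div, div_eq_mul_inv 2]
  have hb' : Tendsto (fun i => ((b i - 1 : ℕ) : ℝ) / n i) l (𝓝 β) := by
    have := hb.sub h.tendsto_inv
    rw [sub_zero] at this
    refine this.congr' ?_
    filter_upwards [hab] with i hi
    rw [Nat.cast_sub (by omega), sub_div, Nat.cast_one, one_div]
  refine tendsto_pi_nhds.2 fun c => tendsto_pi_nhds.2 fun c' => ?_
  have hc := continuous_bridge hw α β
  have h1 := tendsto_riemannSum_of_ultrafilter h.size ha' hb'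
    (by filter_upwards [hab] with i hi; omega)
    (g := fun i m => (scaledDiff θ (y i) (n i) (a i) m (b i)).ofLp c *
      (scaledDiff θ (y i) (n i) (a i) m (b i)).ofLp c')
    (φ := fun s => bridge w α s β c * bridge w α s β c') (by fun_prop) ?_
  · refine h1.congr fun i => ?_
    simp [scaledGram, outer, Matrix.vecMulVec_apply, Matrix.sum_apply]
  · intro U hU hm s hs
    have h2 : Tendsto (fun x : ι × ℕ =>
        (scaledDiff θ (y x.1) (n x.1) (a x.1) x.2 (b x.1)).ofLp) U (𝓝 (bridge w α s β)) := by
      have hU' : IsApprox θ θ₀ ξ (fun x : ι × ℕ => n x.1) (fun x => y x.1) w U := h.comp hU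
      have ha'' : Tendsto (fun x : ι × ℕ => (a x.1 : ℝ) / n x.1) U (𝓝 α) := ha.comp hU
      have hb'' : Tendsto (fun x : ι × ℕ => (b x.1 : ℝ) / n x.1) U (𝓝 β) := hb.comp hU
      refine IsApprox.tendsto_scaledDiff hU' hw (m := Prod.snd) ?_ hlt.ne ha'' hs hb''
      filter_upwards [hm, hU.eventually hbn] with x hx hx'
      omega
    rw [tendsto_pi_nhds] at h2
    exact (h2 c).mul (h2 c')

/-- The extreme split points `a + 1` and `b - 1` add the two blocks of one observation, whose
remainders are controlled by `hra` and `hrb`. -/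
theorem IsApprox.tendsto_scaledGram (h : IsApprox θ θ₀ ξ n y w l) (hw : Continuous w)
    (hbn : ∀ᶠ i in l, b i ≤ n i) (hlt : α < β)
    (ha : Tendsto (fun i => (a i : ℝ) / n i) l (𝓝 α))
    (hb : Tendsto (fun i => (b i : ℝ) / n i) l (𝓝 β))
    (hra : Tendsto (fun i => ‖remainder θ θ₀ ξ (y i) (a i + 1) (a i + 1)‖ / n i) l (𝓝 0))
    (hrb : Tendsto (fun i => ‖remainder θ θ₀ ξ (y i) (b i) (b i)‖ / n i) l (𝓝 0)) :
    Tendsto (fun i => scaledGram θ (y i) (n i) (a i) (b i) (Finset.Ioo (a i) (b i))) l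
      (𝓝 (bridgeGram w α β)) := by
  have hab := h.eventually_add_le hlt ha hb 4
  have ha' : Tendsto (fun i => ((a i + 1 : ℕ) : ℝ) / n i) l (𝓝 α) := by
    have := ha.add h.tendsto_inv
    rw [add_zero] at this
    refine this.congr fun i => ?_
    push_cast
    rw [add_div, one_div]
  have hb' : Tendsto (fun i => ((b i - 1 : ℕ) : ℝ) / n i) l (𝓝 β) := by
    have := hb.sub h.tendsto_inv
    rw [sub_zero] at this
    refine this.congr' ?_
    filter_upwards [hab] with i hi
    rw [Nat.cast_sub (by omega), sub_div, Nat.cast_one, one_div]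
  have hR : Tendsto (fun i => supRemainder θ θ₀ ξ (n i) (y i) / n i) l (𝓝 0) := by
    have := h.rem.mul h.tendsto_inv_sqrt
    rw [zero_mul] at this
    refine this.congr fun i => ?_
    rw [← div_eq_mul_inv, div_div, Real.mul_self_sqrt (Nat.cast_nonneg _)]
  have h1 := h.tendsto_scaledGram_singleton hw (a := a) (m := fun i => a i + 1) (b := b)
    (by filter_upwards [hab, hbn] with i h1 h2; omega) hlt.ne ha ha' hb (by
      refine squeeze_zero' (Eventually.of_forall fun i => by positivity) ?_
        (by simpa using hra.add hR)
      filter_upwards [hab, hbn] with i h1 h2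
      rw [← add_div]
      gcongr
      refine (norm_blockRemainder_le (by omega) (by omega)).trans (add_le_add (le_of_eq ?_)
        (mul_norm_remainder_le (by omega) h2))
      push_cast
      ring)
  have h2 := h.tendsto_scaledGram_singleton hw (a := a) (m := fun i => b i - 1) (b := b)
    (by filter_upwards [hab, hbn] with i h1 h2; omega) hlt.ne ha hb' hb (by
      refine squeeze_zero' (Eventually.of_forall fun i => by positivity) ?_
        (by simpa using hR.add hrb)
      filter_upwards [hab, hbn] with i h1 h2
      rw [← add_div]
      gcongr
      refine (norm_blockRemainder_le (by omega) (by omega)).trans (add_le_add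
        (mul_norm_remainder_le (by omega) (by omega)) (le_of_eq ?_))
      rw [Nat.sub_add_cancel (by omega), Nat.cast_sub (by omega)]
      push_cast
      ring)
  have h3 := (h.tendsto_scaledGram_interior hw hbn hlt ha hb).add (h1.add h2)
  rw [add_zero, add_zero] at h3
  refine h3.congr' ?_
  filter_upwards [hab] with i hi
  have hI : Finset.Ioo (a i) (b i) =
      Finset.Ico (a i + 2) (b i - 1) ∪ ({a i + 1} ∪ {b i - 1}) := by
    ext
    simp only [Finset.mem_Ioo, Finset.mem_union, Finset.mem_Ico, Finset.mem_singleton]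
    omega
  rw [hI]
  simp only [scaledGram]
  rw [Finset.sum_union, Finset.sum_union, smul_add, smul_add]
  · simp only [Finset.disjoint_singleton]
    omega
  · rw [Finset.disjoint_left]
    simp only [Finset.mem_Ico, Finset.mem_union, Finset.mem_singleton]
    omega

/-! ### Asymptotics of the statistic -/

variable {k : ι → ℕ} {μ : ℝ}

theorem IsApprox.tendsto_smul_scaledDiff (h : IsApprox θ θ₀ ξ n y w l) (hw : Continuous w)
    (hbn : ∀ᶠ i in l, b i ≤ n i) (hlt : α < μ) (hlt' : μ < β)
    (ha : Tendsto (fun i => (a i : ℝ) / n i) l (𝓝 α))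
    (hk : Tendsto (fun i => (k i : ℝ) / n i) l (𝓝 μ))
    (hb : Tendsto (fun i => (b i : ℝ) / n i) l (𝓝 β)) :
    Tendsto (fun i => (√((b i : ℝ) / n i - (a i : ℝ) / n i))⁻¹ •
      (scaledDiff θ (y i) (n i) (a i) (k i) (b i)).ofLp) l (𝓝 (limitContrast w α μ β)) := by
  have hlt'' := hlt.trans hlt'
  refine ((hb.sub ha).sqrt.inv₀ (Real.sqrt_pos.2 (sub_pos.2 hlt'')).ne').smul
    (h.tendsto_scaledDiff hw ?_ hlt''.ne ha hk hb)
  filter_upwards [h.eventually_add_le hlt ha hk 2, h.eventually_add_le hlt' hk hb 2, hbn] with i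
    h1 h2 h3 using ⟨h1, h2, h3⟩

theorem IsApprox.tendsto_snStat (h : IsApprox θ θ₀ ξ n y w l) (hw : Continuous w)
    (hbn : ∀ᶠ i in l, b i ≤ n i) (hlt : α < μ) (hlt' : μ < β)
    (hdet : (limitNormalizer w α μ β).det ≠ 0)
    (ha : Tendsto (fun i => (a i : ℝ) / n i) l (𝓝 α))
    (hk : Tendsto (fun i => (k i : ℝ) / n i) l (𝓝 μ))
    (hb : Tendsto (fun i => (b i : ℝ) / n i) l (𝓝 β))
    (hra : Tendsto (fun i => ‖remainder θ θ₀ ξ (y i) (a i + 1) (a i + 1)‖ / n i) l (𝓝 0))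
    (hrk : Tendsto (fun i => ‖remainder θ θ₀ ξ (y i) (k i) (k i)‖ / n i) l (𝓝 0))
    (hrk' : Tendsto (fun i => ‖remainder θ θ₀ ξ (y i) (k i + 1) (k i + 1)‖ / n i) l (𝓝 0))
    (hrb : Tendsto (fun i => ‖remainder θ θ₀ ξ (y i) (b i) (b i)‖ / n i) l (𝓝 0)) :
    Tendsto (fun i => snStat θ (y i) (a i + 1) (k i) (b i)) l (𝓝 (limitStat w α μ β)) := by
  have hak := h.eventually_add_le hlt ha hk 1
  have hkb := h.eventually_add_le hlt' hk hb 1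
  have hkn : ∀ᶠ i in l, k i ≤ n i := by filter_upwards [hkb, hbn] with i h1 h2; omega
  have hpos : (0 : ℝ) < β - α := by linarith
  have h1 := h.tendsto_scaledGram hw hkn hlt ha hk hra hrk
  have h2 := h.tendsto_scaledGram hw hbn hlt' hk hb hrk' hrb
  have h3 := (((hb.sub ha).pow 2).inv₀ (by positivity)).smul (h1.add h2)
  rw [← limitNormalizer_eq] at h3
  refine (tendsto_invForm hdet h3
    (h.tendsto_smul_scaledDiff hw hbn hlt hlt' ha hk hb)).congr' ?_
  filter_upwards [hak, hkb, hkn] with i h1 h2 h3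
  exact (snStat_eq (by omega) (by omega) (by omega)).symm

/-- One-sided, but free of assumptions on single observations: their terms are dropped from the
normalizer, which can only increase the statistic, and the interior part converges. -/
theorem IsApprox.le_limitStat [l.NeBot] (h : IsApprox θ θ₀ ξ n y w l) (hw : Continuous w)
    (hbn : ∀ᶠ i in l, b i ≤ n i) (hlt : α < μ) (hlt' : μ < β)
    (hdet : (limitNormalizer w α μ β).det ≠ 0)
    (ha : Tendsto (fun i => (a i : ℝ) / n i) l (𝓝 α))
    (hk : Tendsto (fun i => (k i : ℝ) / n i) l (𝓝 μ))
    (hb : Tendsto (fun i => (b i : ℝ) / n i) l (𝓝 β)) {c : ℝ}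
    (hc : ∀ᶠ i in l, c ≤ snStat θ (y i) (a i + 1) (k i) (b i)) : c ≤ limitStat w α μ β := by
  have hak := h.eventually_add_le hlt ha hk 1
  have hkb := h.eventually_add_le hlt' hk hb 1
  have hkn : ∀ᶠ i in l, k i ≤ n i := by filter_upwards [hkb, hbn] with i h1 h2; omega
  have hpos : (0 : ℝ) < β - α := by linarith
  have h1 := h.tendsto_scaledGram_interior hw hkn hlt ha hk
  have h2 := h.tendsto_scaledGram_interior hw hbn hlt' hk hb
  have h3 := (((hb.sub ha).pow 2).inv₀ (by positivity)).smul (h1.add h2)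
  rw [← limitNormalizer_eq] at h3
  -- The interior normalizer is positive semidefinite with eventually nonzero determinant, hence
  -- eventually positive definite.
  have hdet' := (((continuous_id.matrix_det).tendsto _).comp h3).eventually_ne hdet
  refine ge_of_tendsto (tendsto_invForm hdet h3
    (h.tendsto_smul_scaledDiff hw hbn hlt hlt' ha hk hb)) ?_
  filter_upwards [hak, hkb, hkn, hc, hdet'] with i h1 h2 h3 h4 h5
  refine h4.trans ?_
  rw [snStat_eq (n := n i) (by omega) (by omega) (by omega),
    scaledGram_sdiff (I := Finset.Ico (a i + 2) (k i - 1)) (J := Finset.Ioo (a i) (k i)),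
    scaledGram_sdiff (I := Finset.Ico (k i + 2) (b i - 1)) (J := Finset.Ioo (k i) (b i)),
    add_add_add_comm, smul_add]
  · refine invForm_add_le ?_ ?_ _
    · refine Matrix.PosSemidef.posDef_iff_det_ne_zero ?_ |>.2 h5
      exact ((posSemidef_scaledGram _ _ _ _).add (posSemidef_scaledGram _ _ _ _)).smul
        (by positivity)
    · exact ((posSemidef_scaledGram _ _ _ _).add (posSemidef_scaledGram _ _ _ _)).smul
        (by positivity)
  · intro t ht
    rw [Finset.mem_Ico] at ht
    rw [Finset.mem_Ioo]
    omega
  · intro t ht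
    rw [Finset.mem_Ico] at ht
    rw [Finset.mem_Ioo]
    omega

end

section

variable {p d : ℕ} {ι : Type*} {l : Filter ι}

/-! ### Convergence of the maximal statistic along a filter -/

section Windows

variable {ε : ℝ}

theorem tendsto_windowSize_div (hε : 0 < ε) {n : ι → ℕ} (hn : Tendsto n l atTop) :
    Tendsto (fun x => (windowSize ε (n x) : ℝ) / n x) l (𝓝 ε) := by
  have h := (tendsto_nat_floor_mul_div_atTop hε.le).comp (tendsto_natCast_atTop_atTop.comp hn)
  refine h.congr fun x => ?_
  simp [windowSize, mul_comm]

theorem windowSize_le (hε : 0 < ε) (n : ℕ) : (windowSize ε n : ℝ) ≤ n * ε :=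
  Nat.floor_le (by positivity)

theorem eventually_windowSize_pos (hε : 0 < ε) {n : ι → ℕ} (hn : Tendsto n l atTop) :
    ∀ᶠ x in l, 0 < windowSize ε (n x) := by
  filter_upwards [(tendsto_windowSize_div hε hn).eventually (lt_mem_nhds hε)] with x hx
  rcases Nat.eq_zero_or_pos (windowSize ε (n x)) with h | h
  · simp [h] at hx
  · exact h

theorem le_maxSN {θ : Measure (EuclideanSpace ℝ (Fin p)) → EuclideanSpace ℝ (Fin d)}
    {y : ℕ → EuclideanSpace ℝ (Fin p)} {n i j k : ℕ} (hi : 1 ≤ i) (hj : 1 ≤ j)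
    (hh : 0 < windowSize ε n) (hik : i * windowSize ε n ≤ k) (hjk : k + j * windowSize ε n ≤ n) :
    snStat θ y (k - i * windowSize ε n + 1) k (k + j * windowSize ε n) ≤ maxSN θ y ε n := by
  have h1 : 1 ≤ i * windowSize ε n := Nat.mul_pos hi hh
  have hq : (k - i * windowSize ε n + 1, k + j * windowSize ε n) ∈ nestedWindows ε n k := by
    refine Finset.mem_image.2 ⟨(i, j), ?_, rfl⟩
    rw [Finset.mem_product, Finset.mem_Icc, Finset.mem_Icc, Nat.le_div_iff_mul_le hh,
      Nat.le_div_iff_mul_le hh]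
    exact ⟨⟨hi, hik⟩, hj, by dsimp only; omega⟩
  exact (le_finMax (f := fun q : ℕ × ℕ => snStat θ y q.1 k q.2) hq).trans
    (le_finMax (f := fun k => finMax (nestedWindows ε n k) fun q => snStat θ y q.1 k q.2)
      (Finset.mem_Icc.2 ⟨by omega, by omega⟩))

theorem exists_of_le_maxSN {θ : Measure (EuclideanSpace ℝ (Fin p)) → EuclideanSpace ℝ (Fin d)}
    {y : ℕ → EuclideanSpace ℝ (Fin p)} {n : ℕ} {c : ℝ} (hc : 0 < c) (h : c ≤ maxSN θ y ε n) :
    ∃ i j k, 1 ≤ i ∧ 1 ≤ j ∧ i * windowSize ε n ≤ k ∧ k + j * windowSize ε n ≤ n ∧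
      c ≤ snStat θ y (k - i * windowSize ε n + 1) k (k + j * windowSize ε n) := by
  obtain ⟨k, hk, h⟩ := exists_le_of_le_finMax hc h
  obtain ⟨q, hq, h⟩ := exists_le_of_le_finMax hc h
  obtain ⟨⟨i, j⟩, hij, rfl⟩ := Finset.mem_image.1 hq
  rw [Finset.mem_product, Finset.mem_Icc, Finset.mem_Icc] at hij
  rw [Finset.mem_Icc] at hk
  have h1 := Nat.mul_le_of_le_div _ _ _ hij.1.2
  have h2 := Nat.mul_le_of_le_div _ _ _ hij.2.2
  exact ⟨i, j, k, hij.1.1, hij.2.1, h1, by dsimp only at h2; omega, h⟩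

/-- The change-point candidate at relative position `a / b` among those which admit the window
with parameters `i`, `j`. -/
def gridPoint (ε : ℝ) (n i j a b : ℕ) : ℕ :=
  i * windowSize ε n + a * (n - (i * windowSize ε n + j * windowSize ε n)) / b

/-- The remainders at the single observations delimiting the blocks at a grid point. -/
def gridRemainder (θ : Measure (EuclideanSpace ℝ (Fin p)) → EuclideanSpace ℝ (Fin d))
    (θ₀ : EuclideanSpace ℝ (Fin d)) (ξ : EuclideanSpace ℝ (Fin p) → EuclideanSpace ℝ (Fin d))
    (ε : ℝ) (n : ℕ) (y : ℕ → EuclideanSpace ℝ (Fin p)) (i j a b : ℕ) : ℝ :=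
  let k := gridPoint ε n i j a b
  let r := fun t => ‖remainder θ θ₀ ξ y (t + 1) (t + 1)‖ / n
  r (k - i * windowSize ε n) + r (k - 1) + r k + r (k + j * windowSize ε n - 1)

/-- Rounding `nε` down keeps the window inside the sample for every `n`, even when `(i+j)ε = 1`.
Placing grid points at a fixed fraction of the remaining slack therefore always gives admissible
candidates. -/
theorem mul_windowSize_add_le (hε : 0 < ε) {i j : ℕ} (h : (i : ℝ) * ε + j * ε ≤ 1) (n : ℕ) :
    i * windowSize ε n + j * windowSize ε n ≤ n := by
  have h1 := windowSize_le hε n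
  have h2 : ((i : ℝ) + j) * windowSize ε n ≤ (i + j) * (n * ε) := by gcongr
  have h3 : (i + j : ℝ) * (n * ε) ≤ n := by
    have : (i + j : ℝ) * (n * ε) = n * (i * ε + j * ε) := by ring
    rw [this]
    exact mul_le_of_le_one_right (Nat.cast_nonneg n) h
  have h4 : ((i * windowSize ε n + j * windowSize ε n : ℕ) : ℝ) ≤ n := by
    push_cast
    linarith
  exact_mod_cast h4

theorem tendsto_gridPoint (hε : 0 < ε) {n : ι → ℕ} (hn : Tendsto n l atTop) {i j a b : ℕ}
    (h : (i : ℝ) * ε + j * ε ≤ 1) :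
    Tendsto (fun x => (gridPoint ε (n x) i j a b : ℝ) / n x) l
      (𝓝 (i * ε + (a : ℝ) / b * (1 - (i * ε + j * ε)))) := by
  have hw := tendsto_windowSize_div hε hn
  have hninv : Tendsto (fun x => (n x : ℝ)⁻¹) l (𝓝 0) :=
    tendsto_inv_atTop_zero.comp (tendsto_natCast_atTop_atTop.comp hn)
  have h1 : Tendsto (fun x => (a : ℝ) / b * (1 - (i * ((windowSize ε (n x) : ℝ) / n x) +
      j * ((windowSize ε (n x) : ℝ) / n x)))) l (𝓝 ((a : ℝ) / b * (1 - (i * ε + j * ε)))) :=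
    (((hw.const_mul (i : ℝ)).add (hw.const_mul (j : ℝ))).const_sub 1).const_mul _
  have h2 : Tendsto (fun x => ((a * (n x - (i * windowSize ε (n x) + j * windowSize ε (n x))) / b :
      ℕ) : ℝ) / n x) l (𝓝 ((a : ℝ) / b * (1 - (i * ε + j * ε)))) := by
    have h1' := h1.sub hninv
    rw [sub_zero] at h1'
    have key : ∀ᶠ x in l, (a : ℝ) / b * (1 - (i * ((windowSize ε (n x) : ℝ) / n x) +
        j * ((windowSize ε (n x) : ℝ) / n x))) =
        (((a * (n x - (i * windowSize ε (n x) + j * windowSize ε (n x))) : ℕ) : ℝ) / b) / n x := by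
      filter_upwards [hn.eventually_gt_atTop 0] with x hx
      have hx' : (n x : ℝ) ≠ 0 := by exact_mod_cast hx.ne'
      rw [Nat.cast_mul, Nat.cast_sub (mul_windowSize_add_le hε h _)]
      push_cast
      field_simp
    refine tendsto_of_tendsto_of_tendsto_of_le_of_le' h1' h1 ?_ ?_
    · filter_upwards [key] with x hx
      rw [hx, ← one_div, ← sub_div]
      gcongr
      rw [← Nat.floor_div_eq_div (K := ℝ)]
      exact (Nat.sub_one_lt_floor _).le
    · filter_upwards [key] with x hx
      rw [hx]
      gcongr
      exact Nat.cast_div_le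
  refine ((hw.const_mul (i : ℝ)).add h2).congr fun x => ?_
  rw [gridPoint, Nat.cast_add, Nat.cast_mul, add_div, mul_div_assoc]

theorem gridPoint_bounds (hε : 0 < ε) {i j a b : ℕ} (hab : a ≤ b)
    (h : (i : ℝ) * ε + j * ε ≤ 1) (n : ℕ) :
    i * windowSize ε n ≤ gridPoint ε n i j a b ∧
      gridPoint ε n i j a b + j * windowSize ε n ≤ n := by
  have h1 := mul_windowSize_add_le hε h n
  refine ⟨Nat.le_add_right _ _, ?_⟩
  rw [gridPoint]
  have h2 : a * (n - (i * windowSize ε n + j * windowSize ε n)) / b ≤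
      n - (i * windowSize ε n + j * windowSize ε n) :=
    Nat.div_le_of_le_mul (Nat.mul_le_mul_right _ hab)
  omega

end Windows

variable {θ : Measure (EuclideanSpace ℝ (Fin p)) → EuclideanSpace ℝ (Fin d)}
  {θ₀ : EuclideanSpace ℝ (Fin d)} {ξ : EuclideanSpace ℝ (Fin p) → EuclideanSpace ℝ (Fin d)}
  {n : ι → ℕ} {y : ι → ℕ → EuclideanSpace ℝ (Fin p)} {w : ℝ → Fin d → ℝ} {ε : ℝ}

/-- Position `u` is a fraction `q` of the slack `1 - (i+j)ε` beyond `iε`. Approximating `q` by the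
rationals `⌊qb⌋/b` suffices by continuity, and leaves countably many grid sequences in total. -/
theorem exists_grid_near {i j : ℕ} {u : ℝ} (hw : IsRegular w ε) (hε : 0 < ε)
    (h : IsWindow ε i j u) {c : ℝ} (hc : c < windowStat w ε i j u) :
    ∃ a b : ℕ, a ≤ b ∧ IsWindow ε i j (i * ε + (a : ℝ) / b * (1 - (i * ε + j * ε))) ∧
      c < windowStat w ε i j (i * ε + (a : ℝ) / b * (1 - (i * ε + j * ε))) := by
  have hL : 0 ≤ 1 - (i * ε + j * ε) := by linarith [h.left_le, h.right_le]
  obtain ⟨q, hq0, hq1, hqu⟩ : ∃ q : ℝ, 0 ≤ q ∧ q ≤ 1 ∧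
      i * ε + q * (1 - (i * ε + j * ε)) = u := by
    rcases hL.eq_or_lt with h0 | h0
    -- Without slack, `u = iε` is the only admissible position.
    · exact ⟨0, le_rfl, zero_le_one, by linarith [h.left_le, h.right_le]⟩
    · refine ⟨(u - i * ε) / (1 - (i * ε + j * ε)), div_nonneg (by linarith [h.left_le]) hL, ?_, ?_⟩
      · rw [div_le_one h0]
        linarith [h.right_le]
      · rw [div_mul_cancel₀ _ h0.ne']
        ring
  have h1 : Tendsto (fun b : ℕ => (⌊q * b⌋₊ : ℝ) / b) atTop (𝓝 q) :=
    (tendsto_nat_floor_mul_div_atTop hq0).comp tendsto_natCast_atTop_atTop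
  have h2 : Tendsto (fun b : ℕ => i * ε + (⌊q * b⌋₊ : ℝ) / b * (1 - (i * ε + j * ε))) atTop
      (𝓝 u) := by
    rw [← hqu]
    exact (h1.mul_const _).const_add _
  have h3 := (hw.tendsto_windowStat hε (F := fun _ => w) (fun _ => hw.continuous)
    (fun v hv => Eventually.of_forall fun _ _ => refl_mem_uniformity hv) h h2).eventually
      (lt_mem_nhds hc)
  obtain ⟨b, hb, hb0⟩ := (h3.and (eventually_gt_atTop 0)).exists
  have hb0' : (0 : ℝ) < b := by exact_mod_cast hb0
  have hab : ⌊q * b⌋₊ ≤ b := Nat.floor_le_of_le (by nlinarith)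
  have hab' : (⌊q * b⌋₊ : ℝ) / b ≤ 1 := by
    rw [div_le_one hb0']
    exact_mod_cast hab
  refine ⟨⌊q * b⌋₊, b, hab, ⟨h.one_le_left, h.one_le_right, ?_, ?_⟩, hb⟩
  · exact le_add_of_nonneg_right (by positivity)
  · have := mul_le_mul_of_nonneg_right hab' hL
    linarith

theorem IsApprox.tendsto_maxSN (h : IsApprox θ θ₀ ξ n y w l) (hw : IsRegular w ε) (hε : 0 < ε)
    (hε' : ε < 1 / 2)
    (hgrid : ∀ i j a b, Tendsto (fun x => gridRemainder θ θ₀ ξ ε (n x) (y x) i j a b) l (𝓝 0)) :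
    Tendsto (fun x => maxSN θ (y x) ε (n x)) l (𝓝 (limitSup w ε (Set.Icc ε (1 - ε)))) := by
  have hwin := tendsto_windowSize_div hε h.size
  have hhpos := eventually_windowSize_pos hε h.size
  refine hw.tendsto_limitSup hε hε' ?_ ?_
  · intro U hU c c' hc hcc hZ
    have hex : ∀ x, ∃ i j k, c' ≤ maxSN θ (y x) ε (n x) →
        1 ≤ i ∧ 1 ≤ j ∧ i * windowSize ε (n x) ≤ k ∧ k + j * windowSize ε (n x) ≤ n x ∧
        c' ≤ snStat θ (y x) (k - i * windowSize ε (n x) + 1) k (k + j * windowSize ε (n x)) := by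
      intro x
      by_cases hx : c' ≤ maxSN θ (y x) ε (n x)
      · obtain ⟨i, j, k, h⟩ := exists_of_le_maxSN (hc.trans hcc) hx
        exact ⟨i, j, k, fun _ => h⟩
      · exact ⟨0, 0, 0, fun h => absurd h hx⟩
    choose i j k hijk using hex
    have hev : ∀ᶠ x in (U : Filter ι), 1 ≤ i x ∧ 1 ≤ j x ∧ i x * windowSize ε (n x) ≤ k x ∧
        k x + j x * windowSize ε (n x) ≤ n x ∧ c' ≤ snStat θ (y x)
          (k x - i x * windowSize ε (n x) + 1) (k x) (k x + j x * windowSize ε (n x)) :=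
      hZ.mono hijk
    have hn0 : ∀ᶠ x in (U : Filter ι), (0 : ℝ) < n x :=
      ((h.size.mono_left hU).eventually_gt_atTop 0).mono fun x hx => by exact_mod_cast hx
    -- Eventually `h/n > ε/2`, so `m h ≤ n` forces `m ≤ 2/ε`.
    have hbound : ∀ m : ι → ℕ, (∀ᶠ x in (U : Filter ι), m x * windowSize ε (n x) ≤ n x) →
        ∀ᶠ x in (U : Filter ι), m x < ⌊2 / ε⌋₊ + 1 := by
      intro m hm
      filter_upwards [hm, hn0,
        (hwin.mono_left hU).eventually (lt_mem_nhds (half_lt_self hε))] with x hx hx0 hx1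
      rw [Nat.lt_add_one_iff, Nat.le_floor_iff (by positivity), le_div_iff₀ hε]
      have h1 : (m x : ℝ) * windowSize ε (n x) ≤ n x := by exact_mod_cast hx
      have h2 : (m x : ℝ) * ((windowSize ε (n x) : ℝ) / n x) ≤ 1 := by
        rw [← mul_div_assoc]
        exact (div_le_one hx0).2 h1
      have h3 : (m x : ℝ) * (ε / 2) ≤ m x * ((windowSize ε (n x) : ℝ) / n x) := by gcongr
      linarith
    obtain ⟨i₀, hi⟩ := exists_eventually_eq_of_lt U
      (hbound i (by filter_upwards [hev] with x hx; omega))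
    obtain ⟨j₀, hj⟩ := exists_eventually_eq_of_lt U
      (hbound j (by filter_upwards [hev] with x hx; omega))
    obtain ⟨u, hu⟩ := exists_tendsto_of_mem_Icc U (f := fun x => (k x : ℝ) / n x) (by
      filter_upwards [hev, hn0] with x hx hx0
      refine ⟨by positivity, (div_le_one hx0).2 ?_⟩
      have : k x ≤ n x := by omega
      exact_mod_cast this)
    have hev' : ∀ᶠ x in (U : Filter ι), 1 ≤ i₀ ∧ 1 ≤ j₀ ∧ i₀ * windowSize ε (n x) ≤ k x ∧
        k x + j₀ * windowSize ε (n x) ≤ n x ∧ c' ≤ snStat θ (y x)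
          (k x - i₀ * windowSize ε (n x) + 1) (k x) (k x + j₀ * windowSize ε (n x)) := by
      filter_upwards [hev, hi, hj] with x h1 h2 h3
      rw [← h2, ← h3]
      exact h1
    have ha : Tendsto (fun x => ((k x - i₀ * windowSize ε (n x) : ℕ) : ℝ) / n x) U
        (𝓝 (u - i₀ * ε)) := by
      refine (hu.sub ((hwin.mono_left hU).const_mul (i₀ : ℝ))).congr' ?_
      filter_upwards [hev'] with x hx
      rw [Nat.cast_sub hx.2.2.1, sub_div, Nat.cast_mul, mul_div_assoc]
    have hb : Tendsto (fun x => ((k x + j₀ * windowSize ε (n x) : ℕ) : ℝ) / n x) U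
        (𝓝 (u + j₀ * ε)) := by
      refine (hu.add ((hwin.mono_left hU).const_mul (j₀ : ℝ))).congr fun x => ?_
      rw [Nat.cast_add, add_div, Nat.cast_mul, mul_div_assoc]
    have hbn : ∀ᶠ x in (U : Filter ι), k x + j₀ * windowSize ε (n x) ≤ n x :=
      hev'.mono fun x hx => hx.2.2.2.1
    have hw₀ : IsWindow ε i₀ j₀ u := by
      obtain ⟨x, hx⟩ := hev'.exists
      refine ⟨hx.1, hx.2.1, ?_, ?_⟩
      · have := ge_of_tendsto' ha (b := 0) fun x => by positivity
        linarith
      · refine le_of_tendsto hb ?_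
        filter_upwards [hbn, hn0] with x hx hx0
        rw [div_le_one hx0]
        exact_mod_cast hx
    refine ⟨_, ⟨i₀, j₀, u, hw₀, rfl⟩, hcc.le.trans ?_⟩
    have hUa : IsApprox θ θ₀ ξ n y w U := h.comp (j := id) hU
    exact hUa.le_limitStat hw.continuous hbn (by linarith [hw₀.left_pos hε])
      (by linarith [hw₀.right_pos hε]) (hw.det_ne_zero _ _ _ hw₀) ha hu hb
      (hev'.mono fun x hx => hx.2.2.2.2)
  · intro i j u₀ hwin₀ c hc₀
    -- The given window is replaced by one at a grid position, where the remainders of single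
    -- observations are known to vanish.
    obtain ⟨a, b, hab, hw₀, hc⟩ := exists_grid_near hw hε hwin₀ hc₀
    have hij : (i : ℝ) * ε + j * ε ≤ 1 := by linarith [hwin₀.left_le, hwin₀.right_le]
    set u := i * ε + (a : ℝ) / b * (1 - (i * ε + j * ε))
    set k := fun x => gridPoint ε (n x) i j a b with hkdef
    have hk : Tendsto (fun x => (k x : ℝ) / n x) l (𝓝 u) := tendsto_gridPoint hε h.size hij
    have hbd : ∀ x, i * windowSize ε (n x) ≤ k x ∧ k x + j * windowSize ε (n x) ≤ n x :=
      fun x => gridPoint_bounds hε hab hij (n x)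
    have hkpos : ∀ᶠ x in l, 0 < k x := by
      filter_upwards [hhpos] with x hx
      exact (Nat.mul_pos hwin₀.one_le_left hx).trans_le (hbd x).1
    have ha : Tendsto (fun x => ((k x - i * windowSize ε (n x) : ℕ) : ℝ) / n x) l
        (𝓝 (u - i * ε)) := by
      refine (hk.sub (hwin.const_mul (i : ℝ))).congr fun x => ?_
      rw [Nat.cast_sub (hbd x).1, sub_div, Nat.cast_mul, mul_div_assoc]
    have hb : Tendsto (fun x => ((k x + j * windowSize ε (n x) : ℕ) : ℝ) / n x) l
        (𝓝 (u + j * ε)) := by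
      refine (hk.add (hwin.const_mul (j : ℝ))).congr fun x => ?_
      rw [Nat.cast_add, add_div, Nat.cast_mul, mul_div_assoc]
    set r : ι → ℕ → ℝ := fun x t => ‖remainder θ θ₀ ξ (y x) (t + 1) (t + 1)‖ / n x with hr
    have hr0 : ∀ x t, 0 ≤ r x t := fun x t => by positivity
    have hgr : ∀ x, gridRemainder θ θ₀ ξ ε (n x) (y x) i j a b =
        r x (k x - i * windowSize ε (n x)) + r x (k x - 1) + r x (k x) +
          r x (k x + j * windowSize ε (n x) - 1) := fun x => rfl
    have hg := hgrid i j a b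
    have h1 : Tendsto (fun x => r x (k x - i * windowSize ε (n x))) l (𝓝 0) :=
      squeeze_zero (fun x => hr0 _ _) (fun x => by
        rw [hgr]
        linarith [hr0 x (k x - 1), hr0 x (k x), hr0 x (k x + j * windowSize ε (n x) - 1)]) hg
    have h2 : Tendsto (fun x => r x (k x - 1)) l (𝓝 0) :=
      squeeze_zero (fun x => hr0 _ _) (fun x => by
        rw [hgr]
        linarith [hr0 x (k x - i * windowSize ε (n x)), hr0 x (k x),
          hr0 x (k x + j * windowSize ε (n x) - 1)]) hg
    have h3 : Tendsto (fun x => r x (k x)) l (𝓝 0) :=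
      squeeze_zero (fun x => hr0 _ _) (fun x => by
        rw [hgr]
        linarith [hr0 x (k x - i * windowSize ε (n x)), hr0 x (k x - 1),
          hr0 x (k x + j * windowSize ε (n x) - 1)]) hg
    have h4 : Tendsto (fun x => r x (k x + j * windowSize ε (n x) - 1)) l (𝓝 0) :=
      squeeze_zero (fun x => hr0 _ _) (fun x => by
        rw [hgr]
        linarith [hr0 x (k x - i * windowSize ε (n x)), hr0 x (k x - 1), hr0 x (k x)]) hg
    have hlim := h.tendsto_snStat hw.continuous (Eventually.of_forall fun x => (hbd x).2)
      (by linarith [hw₀.left_pos hε]) (by linarith [hw₀.right_pos hε])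
      (hw.det_ne_zero _ _ _ hw₀) ha hk hb h1
      -- In `r` the index is shifted by one: `r (k - 1)` belongs to observation `k`, the last of the
      -- left block. The same shift applies to the last observation of the right block.
      (h2.congr' (by
        filter_upwards [hkpos] with x hx
        simp only [hr]
        rw [Nat.sub_add_cancel hx])) h3
      (h4.congr' (by
        filter_upwards [hkpos] with x hx
        simp only [hr]
        rw [Nat.sub_add_cancel (by omega)]))
    filter_upwards [hlim.eventually (lt_mem_nhds hc), hhpos] with x hx hxh
    exact hx.trans_le (le_maxSN hwin₀.one_le_left hwin₀.one_le_right hxh (hbd x).1 (hbd x).2)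

end

section

/-! ### An extended continuous mapping theorem -/

theorem limsup_le_of_le_add_of_tendsto_zero {u v s : ℕ → ℝ≥0∞} {c : ℝ≥0∞}
    (h : ∀ᶠ n in atTop, u n ≤ v n + s n) (hv : limsup v atTop ≤ c) (hs : Tendsto s atTop (𝓝 0)) :
    limsup u atTop ≤ c := by
  refine ENNReal.le_of_forall_pos_le_add fun δ hδ hc => ?_
  have hδ2 : (0 : ℝ≥0∞) < (δ : ℝ≥0∞) / 2 := ENNReal.half_pos (by exact_mod_cast hδ.ne')
  have h1 : ∀ᶠ n in atTop, v n < c + (δ : ℝ≥0∞) / 2 :=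
    eventually_lt_of_limsup_lt (hv.trans_lt (ENNReal.lt_add_right hc.ne hδ2.ne'))
  refine limsup_le_of_le (by isBoundedDefault) ?_
  filter_upwards [h, h1, hs.eventually (gt_mem_nhds hδ2)] with n h1 h2 h3
  calc u n ≤ v n + s n := h1
    _ ≤ (c + (δ : ℝ≥0∞) / 2) + (δ : ℝ≥0∞) / 2 := add_le_add h2.le h3.le
    _ = c + δ := by rw [add_assoc, ENNReal.add_halves]

/-- By the portmanteau theorem it is enough to bound the limsup of `P(Z n ∈ F)` for closed `F`. Up
to events of vanishing probability, `Z n ∈ F` forces `X n` into the closed set `A m`. A point of `C`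
in every `A m` is approached by values of `X` with `Z ∈ F` and vanishing remainders, so `H` puts its
`Φ`-value in `F`. No measurability of the `ρ a` is needed. -/
theorem tendstoInDistribution_of_forall_filter {Ω Ω' E : Type*} [MeasurableSpace Ω]
    [MeasurableSpace Ω'] {P : Measure Ω} [IsProbabilityMeasure P] {P' : Measure Ω'}
    [IsProbabilityMeasure P'] [TopologicalSpace E] [HasOuterApproxClosed E] [MeasurableSpace E]
    [OpensMeasurableSpace E] {X : ℕ → Ω → E} {W : Ω' → E}
    (hX : TendstoInDistribution X atTop W (fun _ => P) P') {Z : ℕ → Ω → ℝ}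
    (hZ : ∀ n, AEMeasurable (Z n) P) {Φ : E → ℝ} (hΦ : AEMeasurable (fun ω => Φ (W ω)) P')
    {ρ : ℕ → ℕ → Ω → ℝ} (hρ : ∀ a, TendstoInMeasure P (ρ a) atTop fun _ => (0 : ℝ)) {C : Set E}
    (hC : ∀ᵐ ω ∂P', W ω ∈ C)
    (H : ∀ x ∈ C, ∀ l : Filter (ℕ × Ω), Tendsto Prod.fst l atTop →
      Tendsto (fun q : ℕ × Ω => X q.1 q.2) l (𝓝 x) →
      (∀ a, Tendsto (fun q : ℕ × Ω => ρ a q.1 q.2) l (𝓝 0)) →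
      Tendsto (fun q : ℕ × Ω => Z q.1 q.2) l (𝓝 (Φ x))) :
    TendstoInDistribution Z atTop (fun ω => Φ (W ω)) (fun _ => P) P' := by
  refine ⟨hZ, hΦ, tendsto_of_forall_isClosed_limsup_le' fun F hF => ?_⟩
  simp only [ProbabilityMeasure.coe_mk]
  rw [Measure.map_apply_of_aemeasurable hΦ hF.measurableSet]
  simp_rw [fun n => Measure.map_apply_of_aemeasurable (hZ n) hF.measurableSet]
  set δ : ℕ → ℝ≥0∞ := fun m => ((m : ℝ≥0∞) + 1)⁻¹
  have hδ : ∀ m, 0 < δ m := fun m => ENNReal.inv_pos.2 (by finiteness)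
  have hδ0 : Tendsto δ atTop (𝓝 0) := by
    have h := (tendsto_add_atTop_iff_nat 1).2 ENNReal.tendsto_inv_nat_nhds_zero
    simpa [δ] using h
  -- At stage `m` only the first `m` remainders are constrained, so finitely many exceptional events
  -- are discarded each time.
  set T : ℕ → Set (ℕ × Ω) := fun m =>
    {q | m ≤ q.1 ∧ (∀ a < m, edist (ρ a q.1 q.2) 0 < δ m) ∧ Z q.1 q.2 ∈ F}
  have hT : Antitone T := by
    intro m m' hmm q hq
    refine ⟨hmm.trans hq.1, fun a ha => (hq.2.1 a (ha.trans_le hmm)).trans_le ?_, hq.2.2⟩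
    simp only [δ]
    gcongr
  set A : ℕ → Set E := fun m => closure ((fun q : ℕ × Ω => X q.1 q.2) '' T m)
  have hA : Antitone A := fun m m' hmm => closure_mono (Set.image_mono (hT hmm))
  have hW := hX.aemeasurable_limit
  have hlim : ∀ m, limsup (fun n => P (Z n ⁻¹' F)) atTop ≤ P'.map W (A m) := by
    intro m
    have h1 := ProbabilityMeasure.limsup_measure_closed_le_of_tendsto hX.tendsto
      (isClosed_closure : IsClosed (A m))
    simp only [ProbabilityMeasure.coe_mk] at h1
    refine limsup_le_of_le_add_of_tendsto_zero
      (s := fun n => ∑ a ∈ Finset.range m, P {ω | δ m ≤ edist (ρ a n ω) 0}) ?_ h1 ?_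
    · filter_upwards [eventually_ge_atTop m] with n hn
      rw [Measure.map_apply_of_aemeasurable (hX.forall_aemeasurable n) isClosed_closure.measurableSet]
      refine le_trans (measure_mono ?_) ((measure_union_le _ _).trans
        (add_le_add le_rfl (measure_biUnion_finset_le _ _)))
      intro ω hω
      by_cases h : ∀ a < m, edist (ρ a n ω) 0 < δ m
      · exact Or.inl (subset_closure ⟨(n, ω), ⟨hn, h, hω⟩, rfl⟩)
      · push Not at h
        obtain ⟨a, ha, h⟩ := h
        exact Or.inr (Set.mem_biUnion (Finset.mem_coe.2 (Finset.mem_range.2 ha)) h)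
    · have h2 := tendsto_finsetSum (Finset.range m) fun a _ => hρ a (δ m) (hδ m)
      simpa using h2
  have hinter : limsup (fun n => P (Z n ⁻¹' F)) atTop ≤ P'.map W (⋂ m, A m) := by
    have : IsProbabilityMeasure (P'.map W) := Measure.isProbabilityMeasure_map hW
    exact ge_of_tendsto' (tendsto_measure_iInter_atTop
      (fun m => isClosed_closure.measurableSet.nullMeasurableSet) hA ⟨0, measure_ne_top _ _⟩) hlim
  refine hinter.trans ?_
  rw [Measure.map_apply_of_aemeasurable hW
    (MeasurableSet.iInter fun m => isClosed_closure.measurableSet)]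
  refine measure_mono_ae ?_
  filter_upwards [hC] with ω hω hωA
  have hωA' : ∀ m, W ω ∈ A m := Set.mem_iInter.1 hωA
  -- This filter plays the role of a sequence in all the `T m` along which `X` tends to `W ω`; it is
  -- proper because `W ω` lies in every closure.
  set l : Filter (ℕ × Ω) := comap (fun q : ℕ × Ω => X q.1 q.2) (𝓝 (W ω)) ⊓ ⨅ m, 𝓟 (T m)
  have hTl : ∀ m, ∀ᶠ q in l, q ∈ T m := fun m =>
    mem_inf_of_right (mem_iInf_of_mem m (mem_principal_self _))
  have hne : l.NeBot := by
    have hb := (Filter.hasBasis_iInf_principal (s := T) (directed_of_isDirected_le hT))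
    refine (((𝓝 (W ω)).basis_sets.comap _).inf hb).neBot_iff.2 ?_
    rintro ⟨s, m⟩ ⟨hs, -⟩
    obtain ⟨_, hxs, q, hq, rfl⟩ := mem_closure_iff_nhds.1 (hωA' m) s hs
    exact ⟨q, hxs, hq⟩
  have hlimZ := H (W ω) hω l
    (tendsto_atTop.2 fun m => (hTl m).mono fun q hq => hq.1)
    (tendsto_iff_comap.2 inf_le_left) (fun a => by
      rw [tendsto_iff_edist_tendsto_0]
      refine ENNReal.tendsto_nhds_zero.2 fun η hη => ?_
      obtain ⟨m, hm, ham⟩ := ((hδ0.eventually (gt_mem_nhds hη)).and (eventually_gt_atTop a)).exists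
      filter_upwards [hTl m] with q hq
      exact ((hq.2.1 a ham).trans hm).le)
  exact hF.mem_of_tendsto hlimZ ((hTl 0).mono fun q hq => hq.2.2)

/-- `C` need not be measurable. Redefining `W` on a null set by one fixed value in `C` gives a
measurable map into the subtype `C`, on which `Φ` is continuous. -/
theorem aemeasurable_comp_of_continuousOn {Ω' E : Type*} [MeasurableSpace Ω'] {P' : Measure Ω'}
    [IsProbabilityMeasure P'] [TopologicalSpace E] [MeasurableSpace E] [BorelSpace E]
    {W : Ω' → E} (hW : AEMeasurable W P') {C : Set E} (hC : ∀ᵐ ω ∂P', W ω ∈ C) {Φ : E → ℝ}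
    (hΦ : ContinuousOn Φ C) : AEMeasurable (fun ω => Φ (W ω)) P' := by
  have h : ∀ᵐ ω ∂P', W ω = hW.mk W ω ∧ W ω ∈ C := hW.ae_eq_mk.and hC
  obtain ⟨s, hs, hsm, hs0⟩ := exists_measurable_superset_of_null (ae_iff.1 h)
  have hsc : ∀ ω ∉ s, W ω = hW.mk W ω ∧ W ω ∈ C := fun ω hω => by
    by_contra hcon
    exact hω (hs hcon)
  have hsae : ∀ᵐ ω ∂P', ω ∉ s := measure_eq_zero_iff_ae_notMem.1 hs0
  obtain ⟨ω₀, hω₀⟩ := hC.exists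
  classical
  let V : Ω' → E := fun ω => if ω ∈ s then W ω₀ else hW.mk W ω
  have hV : Measurable V := Measurable.ite hsm measurable_const hW.measurable_mk
  have hVC : ∀ ω, V ω ∈ C := by
    intro ω
    by_cases hω : ω ∈ s
    · simpa [V, hω] using hω₀
    · simpa [V, hω, ← (hsc ω hω).1] using (hsc ω hω).2
  have hm : Measurable fun ω => C.domRestrict Φ ⟨V ω, hVC ω⟩ :=
    (continuousOn_iff_continuous_domRestrict.1 hΦ).measurable.comp (hV.subtype_mk)
  refine ⟨_, hm, ?_⟩
  filter_upwards [hsae] with ω hω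
  simp [V, hω, (hsc ω hω).1, Set.domRestrict]

end

section

/-! ### Almost sure nondegeneracy of Brownian paths -/

theorem ae_pi_of_ae_prod {n : ℕ} {V : Type*} [MeasurableSpace V] (μ : Fin (n + 1) → Measure V)
    [∀ i, SigmaFinite (μ i)] (i : Fin (n + 1)) {p : (Fin n → V) → V → Prop}
    (hp : MeasurableSet {z : (Fin n → V) × V | p z.1 z.2})
    (h : ∀ᵐ x ∂Measure.pi fun j => μ (i.succAbove j), ∀ᵐ v ∂μ i, p x v) :
    ∀ᵐ x ∂Measure.pi μ, p (fun j => x (i.succAbove j)) (x i) := by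
  have h1 : ∀ᵐ z ∂(Measure.pi fun j => μ (i.succAbove j)).prod (μ i), p z.1 z.2 :=
    (Measure.ae_prod_iff_ae_ae hp).2 h
  have h2 := (Measure.measurePreserving_swap (μ := μ i)
    (ν := Measure.pi fun j => μ (i.succAbove j))).comp (measurePreserving_piFinSuccAbove μ i)
  exact h2.quasiMeasurePreserving.ae h1

/-- Given the other coordinates, one with nonzero coefficient would have to hit a single value, a
null event for an atomless law. -/
theorem ae_pi_dotProduct_ne_zero {m : ℕ} (μ : Fin m → Measure ℝ) [∀ i, SigmaFinite (μ i)]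
    (hμ : ∀ i c, μ i {c} = 0) {v : Fin m → ℝ} (hv : v ≠ 0) :
    ∀ᵐ x ∂Measure.pi μ, ∑ i, x i * v i ≠ 0 := by
  obtain ⟨i, hi⟩ := Function.ne_iff.1 hv
  obtain ⟨n, rfl⟩ : ∃ n, m = n + 1 := ⟨m - 1, by have := i.pos; omega⟩
  simp_rw [Fin.sum_univ_succAbove _ i]
  refine ae_pi_of_ae_prod μ i (p := fun x c => c * v i + ∑ j, x j * v (i.succAbove j) ≠ 0) ?_ ?_
  · refine (measurableSet_eq_fun ?_ measurable_const).compl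
    fun_prop
  · refine Eventually.of_forall fun x => ?_
    have h : ∀ᵐ c ∂μ i, c ≠ -(∑ j, x j * v (i.succAbove j)) / v i :=
      compl_mem_ae_iff.2 (hμ i _)
    filter_upwards [h] with c hc h0
    refine hc ?_
    rw [eq_div_iff hi]
    linarith

theorem ae_pi_notMem_submodule {m : ℕ} (μ : Fin m → Measure ℝ) [∀ i, SigmaFinite (μ i)]
    (hμ : ∀ i c, μ i {c} = 0) {p : Submodule ℝ (Fin m → ℝ)} (hp : p < ⊤) :
    ∀ᵐ x ∂Measure.pi μ, x ∉ p := by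
  obtain ⟨f, hf, hpf⟩ := Submodule.exists_le_ker_of_lt_top p hp
  have hv : (fun i => f fun j => if i = j then 1 else 0) ≠ 0 := by
    intro h0
    refine hf (LinearMap.ext fun x => ?_)
    rw [LinearMap.pi_apply_eq_sum_univ]
    have h1 := fun i => congrFun h0 i
    simp only [Pi.zero_apply] at h1
    simp [h1]
  filter_upwards [ae_pi_dotProduct_ne_zero μ hμ hv] with x hx hxp
  refine hx ?_
  have := LinearMap.mem_ker.1 (hpf hxp)
  rwa [LinearMap.pi_apply_eq_sum_univ] at this

/-- The random vectors are added one at a time: before each step there are fewer than `m` vectors,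
so they span a proper subspace, which the next independent vector almost surely avoids. -/
theorem ae_pi_linearIndependent_snoc {m : ℕ} {u : Fin m → ℝ} (hu : u ≠ 0)
    (ν : Measure (Fin m → ℝ)) [SigmaFinite ν]
    (hν : ∀ p : Submodule ℝ (Fin m → ℝ), p < ⊤ → ∀ᵐ x ∂ν, x ∉ p) (k : ℕ) (hk : k < m) :
    ∀ᵐ x ∂Measure.pi fun _ : Fin k => ν,
      LinearIndependent ℝ (Fin.snoc x u : Fin (k + 1) → Fin m → ℝ) := by
  induction k with
  | zero =>
    refine Eventually.of_forall fun x => ?_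
    rw [linearIndependent_finSnoc]
    refine ⟨linearIndependent_empty_type, ?_⟩
    simpa [Set.range_eq_empty] using hu
  | succ k ih =>
    have h := ae_pi_of_ae_prod (fun _ : Fin (k + 1) => ν) 0 (p := fun x v =>
      LinearIndependent ℝ (Fin.snoc (Fin.cons v x) u : Fin (k + 1 + 1) → Fin m → ℝ)) ?_ ?_
    · filter_upwards [h] with x hx
      have e : (Fin.cons (x 0) fun j => x (Fin.succAbove 0 j) : Fin (k + 1) → Fin m → ℝ) = x :=
        Fin.cons_self_tail x
      rwa [e] at hx
    · have hc : Continuous fun z : (Fin k → Fin m → ℝ) × (Fin m → ℝ) =>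
          (Fin.snoc (Fin.cons z.2 z.1) u : Fin (k + 1 + 1) → Fin m → ℝ) := by
        refine continuous_pi fun j => ?_
        induction j using Fin.lastCases with
        | last => simpa using continuous_const
        | cast j =>
          induction j using Fin.cases with
          | zero => simpa only [Fin.snoc_castSucc, Fin.cons_zero] using continuous_snd
          | succ j =>
            simp only [Fin.snoc_castSucc, Fin.cons_succ]
            fun_prop
      exact ((isOpen_setOfPred_linearIndependent (𝕜 := ℝ)).preimage hc).measurableSet
    · filter_upwards [ih (by omega)] with x hx
      have hlt : Submodule.span ℝ (Set.range (Fin.snoc x u : Fin (k + 1) → Fin m → ℝ)) < ⊤ := by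
        refine lt_top_iff_ne_top.2 fun htop => ?_
        have h1 := finrank_range_le_card (R := ℝ) (Fin.snoc x u : Fin (k + 1) → Fin m → ℝ)
        rw [Set.finrank, htop, finrank_top, Module.finrank_fin_fun, Fintype.card_fin] at h1
        omega
      filter_upwards [hν _ hlt] with v hv
      rw [← Fin.cons_snoc_eq_snoc_cons]
      exact linearIndependent_finCons.2 ⟨hx, hv⟩

variable {d : ℕ}

/-- The increments of the components of `w` over `d + 1` consecutive intervals of equal length in
`[a, b]`. -/
def increments (w : ℝ → Fin d → ℝ) (a b : ℝ) (c : Fin d) (i : Fin (d + 1)) : ℝ :=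
  w (a + (b - a) * ((i : ℕ) + 1) / (d + 1)) c - w (a + (b - a) * (i : ℕ) / (d + 1)) c

/-- If the bridge is orthogonal to `v` throughout, then `v ⬝ᵥ w` is affine on `[α, μ]`. On a
rational subinterval its equal-length increments all equal `κ`, so the coefficients `v` and `-κ`
give a linear relation between the increment vectors and the constant vector `1`. -/
theorem exists_dotProduct_bridge_ne_zero {w : ℝ → Fin d → ℝ}
    (hw : ∀ a b : ℚ, 0 ≤ a → a < b →
      LinearIndependent ℝ (Fin.snoc (increments w a b) 1 : Fin (d + 1) → Fin (d + 1) → ℝ))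
    {α μ : ℝ} (hα : 0 ≤ α) (hlt : α < μ) {v : Fin d → ℝ} (hv : v ≠ 0) :
    ∃ s ∈ Set.Icc α μ, v ⬝ᵥ bridge w α s μ ≠ 0 := by
  by_contra! hcon
  obtain ⟨a, ha1, ha2⟩ := exists_rat_btwn hlt
  obtain ⟨b, hb1, hb2⟩ := exists_rat_btwn ha2
  have hli := hw a b (by exact_mod_cast hα.trans ha1.le) (by exact_mod_cast hb1)
  have hd : (0 : ℝ) < d + 1 := by positivity
  have haff : ∀ s ∈ Set.Icc α μ,
      v ⬝ᵥ w s = v ⬝ᵥ w α + (s - α) / (μ - α) * (v ⬝ᵥ (w μ - w α)) := by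
    intro s hs
    have h := hcon s hs
    rw [bridge, dotProduct_sub, dotProduct_sub, dotProduct_smul, smul_eq_mul] at h
    linarith
  have hmem : ∀ x : ℝ, 0 ≤ x → x ≤ d + 1 → (a : ℝ) + (b - a) * x / (d + 1) ∈ Set.Icc α μ := by
    intro x hx hx'
    have h1 : 0 ≤ ((b : ℝ) - a) * x / (d + 1) :=
      div_nonneg (mul_nonneg (by linarith) hx) hd.le
    have h2 : ((b : ℝ) - a) * x / (d + 1) ≤ b - a := by
      rw [div_le_iff₀ hd]
      gcongr
    constructor <;> linarith
  set κ := ((b : ℝ) - a) / (d + 1) / (μ - α) * (v ⬝ᵥ (w μ - w α)) with hκ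
  have hinc : ∀ i : Fin (d + 1), ∑ c, v c * increments w a b c i = κ := by
    intro i
    have hi : ((i : ℕ) : ℝ) + 1 ≤ d + 1 := by exact_mod_cast Nat.succ_le_of_lt i.2
    have e1 := haff _ (hmem (i : ℕ) (by positivity) (by linarith))
    have e2 := haff _ (hmem ((i : ℕ) + 1) (by positivity) hi)
    have e3 : ∑ c, v c * increments w a b c i =
        v ⬝ᵥ w (a + (b - a) * ((i : ℕ) + 1) / (d + 1)) -
          v ⬝ᵥ w (a + (b - a) * (i : ℕ) / (d + 1)) := by
      simp only [increments, dotProduct, mul_sub, Finset.sum_sub_distrib]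
    rw [e3, e1, e2, hκ]
    have : μ - α ≠ 0 := (sub_pos.2 hlt).ne'
    field_simp
    ring
  rw [Fintype.linearIndependent_iff] at hli
  have h0 := hli (Fin.snoc v (-κ)) (by
    ext i
    rw [Fin.sum_univ_castSucc]
    simp only [Fin.snoc_castSucc, Fin.snoc_last, Pi.add_apply, Finset.sum_apply, Pi.smul_apply,
      smul_eq_mul, Pi.one_apply, Pi.zero_apply, hinc i]
    ring)
  refine hv (funext fun c => ?_)
  simpa using h0 c.castSucc

/-- The `d` increment vectors are independent, with product Gaussian laws of positive variances.
Taking `d + 1` subintervals leaves room for the constant vector as well. -/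
theorem IsBrownianVec.ae_linearIndependent_increments {Ω : Type*} [MeasurableSpace Ω]
    {P : Measure Ω} [IsProbabilityMeasure P] {B : Fin d → ℝ≥0 → Ω → ℝ} (hB : IsBrownianVec B P)
    {a b : ℝ} (ha : 0 ≤ a) (hab : a < b) :
    ∀ᵐ ω ∂P, LinearIndependent ℝ
      (Fin.snoc (increments (pathOf B ω) a b) 1 : Fin (d + 1) → Fin (d + 1) → ℝ) := by
  have hd : (0 : ℝ) < d + 1 := by positivity
  set t : Fin (d + 1 + 1) → ℝ≥0 := fun i => (a + (b - a) * (i : ℕ) / (d + 1)).toNNReal with ht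
  have hpos : ∀ x : ℕ, 0 ≤ a + (b - a) * (x : ℝ) / (d + 1) := fun x =>
    add_nonneg ha (div_nonneg (mul_nonneg (by linarith) (Nat.cast_nonneg _)) hd.le)
  have htm : Monotone t := by
    intro i j hij
    refine Real.toNNReal_le_toNNReal ?_
    have h1 : ((i : ℕ) : ℝ) ≤ (j : ℕ) := by exact_mod_cast hij
    have h2 : 0 ≤ b - a := by linarith
    gcongr
  set V : Fin d → Ω → Fin (d + 1) → ℝ := fun c ω i => B c (t i.succ) ω - B c (t i.castSucc) ω
  have hVinc : ∀ ω, increments (pathOf B ω) a b = fun c => V c ω := by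
    intro ω
    ext c i
    simp [increments, pathOf, V, ht]
  set v : Fin (d + 1) → ℝ≥0 := fun i => nndist (t i.succ : ℝ) (t i.castSucc : ℝ)
  have hv : ∀ i, v i ≠ 0 := by
    intro i
    rw [Ne, nndist_eq_zero]
    simp only [ht, Fin.val_succ, Fin.val_castSucc]
    rw [Real.coe_toNNReal _ (hpos _), Real.coe_toNNReal _ (hpos _)]
    have h1 : (b - a) * ((i : ℕ) : ℝ) / (d + 1) < (b - a) * (((i : ℕ) + 1 : ℕ) : ℝ) / (d + 1) := by
      have h2 : 0 < b - a := by linarith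
      gcongr
      simp
    linarith
  have hVm : ∀ c i, AEMeasurable (fun ω => V c ω i) P := fun c i =>
    ((hB.isBrownian c).aemeasurable _).sub ((hB.isBrownian c).aemeasurable _)
  have hVm' : ∀ c, AEMeasurable (V c) P := fun c => aemeasurable_pi_lambda _ (hVm c)
  set ν : Measure (Fin (d + 1) → ℝ) := Measure.pi fun i => gaussianReal 0 (v i)
  have hlaw : ∀ c, P.map (V c) = ν := by
    intro c
    have h1 := ((hB.isBrownian c).hasIndepIncrements (d + 1) t htm).map_fun_eq_pi_map (hVm c)
    refine h1.trans ?_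
    congr 1
    ext1 i
    exact ((hB.isBrownian c).hasLaw_sub (t i.succ) (t i.castSucc)).map_eq
  have hindep : iIndepFun V P := by
    have hm : Measurable fun (x : ℝ≥0 → ℝ) (i : Fin (d + 1)) => x (t i.succ) - x (t i.castSucc) :=
      measurable_pi_lambda _ fun i => (measurable_pi_apply _).sub (measurable_pi_apply _)
    exact hB.indep.comp (fun _ => fun (x : ℝ≥0 → ℝ) (i : Fin (d + 1)) =>
      x (t i.succ) - x (t i.castSucc)) fun _ => hm
  have hjoint : P.map (fun ω c => V c ω) = Measure.pi fun _ : Fin d => ν := by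
    rw [hindep.map_fun_eq_pi_map hVm']
    simp_rw [hlaw]
  have hae := ae_pi_linearIndependent_snoc (u := (1 : Fin (d + 1) → ℝ)) one_ne_zero ν
    (fun p hp => ae_pi_notMem_submodule _ (fun i c => by
      have := nullSingletonClass_gaussianReal (μ := 0) (hv i)
      exact measure_singleton c) hp) d (Nat.lt_succ_self d)
  rw [← hjoint] at hae
  filter_upwards [ae_of_ae_map (aemeasurable_pi_lambda _ hVm') hae] with ω hω
  rw [hVinc]
  exact hω

theorem IsBrownianVec.ae_continuous {Ω : Type*} [MeasurableSpace Ω] {P : Measure Ω}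
    {B : Fin d → ℝ≥0 → Ω → ℝ} (hB : IsBrownianVec B P) : ∀ᵐ ω ∂P, Continuous (pathOf B ω) := by
  filter_upwards [ae_all_iff.2 fun c => (hB.isBrownian c).cont] with ω hω
  exact continuous_pi fun c => (hω c).comp continuous_real_toNNReal

/-- The exceptional null set is taken over rational intervals only; every real window contains one,
so a single null set serves uncountably many windows. -/
theorem IsBrownianVec.ae_posDef {Ω : Type*} [MeasurableSpace Ω] {P : Measure Ω}
    [IsProbabilityMeasure P] {B : Fin d → ℝ≥0 → Ω → ℝ} (hB : IsBrownianVec B P) :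
    ∀ᵐ ω ∂P, ∀ α μ β : ℝ, 0 ≤ α → α < μ → μ ≤ β →
      (limitNormalizer (pathOf B ω) α μ β).PosDef := by
  have h : ∀ᵐ ω ∂P, ∀ a b : ℚ, 0 ≤ a → a < b → LinearIndependent ℝ
      (Fin.snoc (increments (pathOf B ω) a b) 1 : Fin (d + 1) → Fin (d + 1) → ℝ) := by
    rw [ae_all_iff]
    intro a
    rw [ae_all_iff]
    intro b
    by_cases hab : 0 ≤ a ∧ a < b
    · filter_upwards [hB.ae_linearIndependent_increments (a := a) (b := b)
        (by exact_mod_cast hab.1) (by exact_mod_cast hab.2)] with ω hω _ _ using hω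
    · exact Eventually.of_forall fun ω h1 h2 => absurd ⟨h1, h2⟩ hab
  filter_upwards [h, hB.ae_continuous] with ω h1 h2 α μ β hα hαμ hμβ
  exact posDef_limitNormalizer h2 hαμ hμβ fun v hv =>
    exists_dotProduct_bridge_ne_zero h1 hα hαμ hv

end

section

variable {p d : ℕ}

/-! ### Measurability of the statistic -/

theorem measurable_finMax {α β : Type*} [MeasurableSpace α] {S : Finset β} {f : β → α → ℝ}
    (hf : ∀ b ∈ S, Measurable (f b)) : Measurable fun x => finMax S fun b => f b x := by
  by_cases hS : S.Nonempty
  · simp only [finMax, dif_pos hS]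
    convert Finset.measurable_sup' hS hf using 2 with x
    rw [Finset.sup'_apply]
  · simp only [finMax, dif_neg hS]
    exact measurable_const

theorem measurable_det {α : Type*} [MeasurableSpace α] {M : α → Matrix (Fin d) (Fin d) ℝ}
    (hM : ∀ i j, Measurable fun x => M x i j) : Measurable fun x => (M x).det := by
  simp only [Matrix.det_apply]
  fun_prop

theorem measurable_invForm {α : Type*} [MeasurableSpace α] {M : α → Matrix (Fin d) (Fin d) ℝ}
    (hM : ∀ i j, Measurable fun x => M x i j) {v : α → Fin d → ℝ}
    (hv : ∀ i, Measurable fun x => v x i) : Measurable fun x => invForm (M x) (v x) := by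
  have hadj : ∀ i j, Measurable fun x => (M x).adjugate i j := by
    intro i j
    simp only [Matrix.adjugate_apply]
    refine measurable_det fun i' j' => ?_
    simp only [Matrix.updateRow_apply]
    split_ifs
    · exact measurable_const
    · exact hM i' j'
  have hdet := measurable_det hM
  simp only [invForm, Matrix.inv_def, Ring.inverse_eq_inv', dotProduct, Matrix.mulVec,
    Matrix.smul_apply, smul_eq_mul]
  fun_prop

section Measurability

variable {θ : Measure (EuclideanSpace ℝ (Fin p)) → EuclideanSpace ℝ (Fin d)}
  (hθ : ∀ a b : ℕ, 1 ≤ a → a ≤ b →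
    Measurable fun y : ℕ → EuclideanSpace ℝ (Fin p) => thetaHat θ y a b)
include hθ

theorem measurable_scaledDiff (n : ℕ) {a m b : ℕ} (ham : a < m) (hmb : m < b) (c : Fin d) :
    Measurable fun y => (scaledDiff θ y n a m b).ofLp c := by
  have h1 := hθ (a + 1) m (by omega) (by omega)
  have h2 := hθ (m + 1) b (by omega) (by omega)
  simp only [scaledDiff, blockDiff]
  fun_prop

theorem measurable_scaledGram (n a b : ℕ) (i j : Fin d) :
    Measurable fun y => scaledGram θ y n a b (Finset.Ioo a b) i j := by
  simp only [scaledGram, outer, Matrix.smul_apply, Matrix.sum_apply, Matrix.vecMulVec_apply,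
    smul_eq_mul]
  refine (Finset.measurable_fun_sum _ fun m hm => ?_).const_mul _
  rw [Finset.mem_Ioo] at hm
  exact (measurable_scaledDiff hθ n hm.1 hm.2 i).mul (measurable_scaledDiff hθ n hm.1 hm.2 j)

theorem measurable_snStat {a k b : ℕ} (hak : a < k) (hkb : k < b) :
    Measurable fun y => snStat θ y (a + 1) k b := by
  -- The defining formula also mentions estimators on empty blocks, about which `hθ` says nothing;
  -- this form does not.
  simp only [fun y => snStat_eq (θ := θ) (y := y) one_pos hak hkb]
  refine measurable_invForm (fun i j => ?_) fun i => ?_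
  · simp only [Matrix.smul_apply, Matrix.add_apply, smul_eq_mul]
    exact ((measurable_scaledGram hθ 1 a k i j).add
      (measurable_scaledGram hθ 1 k b i j)).const_mul _
  · simp only [Pi.smul_apply, smul_eq_mul]
    exact (measurable_scaledDiff hθ 1 hak hkb i).const_mul _

theorem measurable_maxSN (ε : ℝ) (n : ℕ) : Measurable fun y => maxSN θ y ε n := by
  refine measurable_finMax fun k hk => measurable_finMax fun q hq => ?_
  obtain ⟨⟨i, j⟩, hij, rfl⟩ := Finset.mem_image.1 hq
  rw [Finset.mem_product, Finset.mem_Icc, Finset.mem_Icc] at hij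
  dsimp only at hij ⊢
  have hh : 0 < windowSize ε n := by
    rcases Nat.eq_zero_or_pos (windowSize ε n) with h | h
    -- A window size of zero makes the quotients zero, and the window set is empty.
    · rw [h, Nat.div_zero] at hij
      omega
    · exact h
  have h1 : 0 < i * windowSize ε n := Nat.mul_pos hij.1.1 hh
  have h2 : 0 < j * windowSize ε n := Nat.mul_pos hij.2.1 hh
  have h3 := Nat.mul_le_of_le_div _ _ _ hij.1.2
  exact measurable_snStat hθ (by omega) (by omega)

end Measurability

/-! ### Skorokhod convergence to a continuous path -/

/-- The time change in the Skorokhod distance is uniformly close to the identity, and a continuous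
limit on `[0,1]` is uniformly continuous, so the time change can be removed. -/
theorem tendstoUniformly_pathFun {ι : Type*} {l : Filter ι} {X : ι → DSpace d} {x : DSpace d}
    (hx : Continuous (pathFun x)) (hX : Tendsto X l (𝓝 x)) :
    TendstoUniformly (fun i => pathFun (X i)) (pathFun x) l := by
  have hval : ∀ (z : DSpace d) (t : unitInterval), pathFun z t = (z.toFun t).ofLp := fun z t => by
    simp only [pathFun, Set.projIcc_val]
  have huc : UniformContinuous fun t : unitInterval => pathFun x t :=
    CompactSpace.uniformContinuous_of_continuous (hx.comp continuous_subtype_val)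
  rw [Metric.tendstoUniformly_iff]
  intro η hη
  obtain ⟨δ, hδ, hδη⟩ := Metric.uniformContinuous_iff.1 huc (η / 2) (half_pos hη)
  have hev := (EMetric.tendsto_nhds.1 hX) (ENNReal.ofReal (min δ (η / 2)))
    (ENNReal.ofReal_pos.2 (lt_min hδ (half_pos hη)))
  filter_upwards [hev] with i hi s
  have hi' : skorokhodEDist (X i) x < ENNReal.ofReal (min δ (η / 2)) := hi
  obtain ⟨e, he⟩ := iInf_lt_iff.1 hi'
  obtain ⟨he1, he2⟩ := max_lt_iff.1 he
  set t := Set.projIcc (0 : ℝ) 1 zero_le_one s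
  have h1 : dist (e t) t < δ := by
    have := (le_iSup (fun t => edist (e t) t) t).trans_lt he1
    rw [edist_dist] at this
    exact ((ENNReal.ofReal_lt_ofReal_iff_of_nonneg dist_nonneg).1 this).trans_le (min_le_left _ _)
  have h2 : dist ((X i).toFun t) (x.toFun (e t)) < η / 2 := by
    have := (le_iSup (fun t => edist ((X i).toFun t) (x.toFun (e t))) t).trans_lt he2
    rw [edist_dist] at this
    exact ((ENNReal.ofReal_lt_ofReal_iff_of_nonneg dist_nonneg).1 this).trans_le (min_le_right _ _)
  have h3 := hδη h1
  have h4 : dist ((X i).toFun t).ofLp (x.toFun (e t)).ofLp ≤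
      dist ((X i).toFun t) (x.toFun (e t)) := by
    rw [dist_eq_norm, dist_eq_norm]
    exact norm_ofLp_le _
  rw [hval, hval] at h3
  change dist (x.toFun t).ofLp ((X i).toFun t).ofLp < η
  calc dist (x.toFun t).ofLp ((X i).toFun t).ofLp
      ≤ dist (x.toFun t).ofLp (x.toFun (e t)).ofLp +
        dist (x.toFun (e t)).ofLp ((X i).toFun t).ofLp := dist_triangle _ _ _
    _ < η := by
      rw [dist_comm (x.toFun t).ofLp, dist_comm (x.toFun (e t)).ofLp ((X i).toFun t).ofLp]
      linarith

theorem continuousOn_limitSup {ε : ℝ} (hε : 0 < ε) (hε' : ε < 1 / 2) :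
    ContinuousOn (fun x : DSpace d => limitSup (pathFun x) ε (Set.Icc ε (1 - ε)))
      {x | IsRegular (pathFun x) ε} := by
  rw [continuousOn_iff_continuous_domRestrict, continuous_iff_continuousAt]
  intro x
  exact x.2.tendsto_limitSup_of_tendstoUniformly hε hε' (fun z => z.2)
    (tendstoUniformly_pathFun x.2.continuous continuous_subtype_val.continuousAt)

/-! ### Invariance of the limit under linear maps -/

theorem bridge_mulVec (A : Matrix (Fin d) (Fin d) ℝ) (w : ℝ → Fin d → ℝ) (a s b : ℝ) :
    bridge (fun s => A *ᵥ w s) a s b = A *ᵥ bridge w a s b := by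
  simp only [bridge, Matrix.mulVec_sub, Matrix.mulVec_smul]

theorem bridgeGram_mulVec (A : Matrix (Fin d) (Fin d) ℝ) {w : ℝ → Fin d → ℝ} (hw : Continuous w)
    (a b : ℝ) : bridgeGram (fun s => A *ᵥ w s) a b = A * bridgeGram w a b * Aᵀ := by
  have hc := continuous_bridge hw a b
  ext i j
  simp only [bridgeGram, Matrix.of_apply, bridge_mulVec, Matrix.mul_apply, Matrix.transpose_apply]
  have h1 : ∀ s, (A *ᵥ bridge w a s b) i * (A *ᵥ bridge w a s b) j =
      ∑ l, ∑ k, A i k * (bridge w a s b k * bridge w a s b l) * A j l := by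
    intro s
    rw [mul_comm, Matrix.mulVec, Matrix.mulVec, dotProduct, dotProduct, Finset.sum_mul_sum]
    exact Finset.sum_congr rfl fun l _ => Finset.sum_congr rfl fun k _ => by ring
  simp_rw [h1]
  rw [intervalIntegral.integral_finsetSum fun l _ =>
    Continuous.intervalIntegrable (by fun_prop) _ _]
  refine Finset.sum_congr rfl fun l _ => ?_
  rw [intervalIntegral.integral_finsetSum fun k _ =>
    Continuous.intervalIntegrable (by fun_prop) _ _, Finset.sum_mul]
  refine Finset.sum_congr rfl fun k _ => ?_
  rw [intervalIntegral.integral_mul_const, intervalIntegral.integral_const_mul]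

theorem limitNormalizer_mulVec (A : Matrix (Fin d) (Fin d) ℝ) {w : ℝ → Fin d → ℝ}
    (hw : Continuous w) (a u b : ℝ) :
    limitNormalizer (fun s => A *ᵥ w s) a u b = A * limitNormalizer w a u b * Aᵀ := by
  simp only [limitNormalizer_eq, bridgeGram_mulVec A hw, Matrix.mul_smul, Matrix.smul_mul,
    Matrix.mul_add, Matrix.add_mul]

/-- The contrast becomes `A D` and the normalizer `A V Aᵀ`, so `A` cancels in the quadratic form.
This makes the limit free of the covariance matrix. -/
theorem limitStat_mulVec {A : Matrix (Fin d) (Fin d) ℝ} (hA : A.det ≠ 0) {w : ℝ → Fin d → ℝ}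
    (hw : Continuous w) (a u b : ℝ) :
    limitStat (fun s => A *ᵥ w s) a u b = limitStat w a u b := by
  have hA' : IsUnit A.det := isUnit_iff_ne_zero.2 hA
  have h1 : limitContrast (fun s => A *ᵥ w s) a u b = A *ᵥ limitContrast w a u b := by
    simp only [limitContrast, bridge_mulVec, Matrix.mulVec_smul]
  set v := limitContrast w a u b with hv
  rw [limitStat_eq, limitStat_eq, h1, limitNormalizer_mulVec A hw, invForm, invForm,
    Matrix.mul_inv_rev, Matrix.mul_inv_rev, Matrix.mulVec_mulVec, Matrix.mul_assoc,
    Matrix.mul_assoc, Matrix.nonsing_inv_mul _ hA', Matrix.mul_one, ← Matrix.mulVec_mulVec,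
    Matrix.dotProduct_mulVec, ← Matrix.mulVec_transpose, Matrix.mulVec_mulVec,
    Matrix.transpose_nonsing_inv, Matrix.transpose_transpose, Matrix.nonsing_inv_mul _ hA',
    Matrix.one_mulVec, ← hv]

section Congr

variable {w w' : ℝ → Fin d → ℝ} {a u b : ℝ}

theorem bridgeGram_congr (hab : a ≤ b) (h : ∀ s ∈ Set.Icc a b, w s = w' s) :
    bridgeGram w a b = bridgeGram w' a b := by
  ext i j
  refine intervalIntegral.integral_congr fun s hs => ?_
  rw [Set.uIcc_of_le hab] at hs
  simp only [bridge, h s hs, h a ⟨le_rfl, hab⟩, h b ⟨hab, le_rfl⟩]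

theorem limitNormalizer_congr (hau : a ≤ u) (hub : u ≤ b) (h : ∀ s ∈ Set.Icc a b, w s = w' s) :
    limitNormalizer w a u b = limitNormalizer w' a u b := by
  rw [limitNormalizer_eq, limitNormalizer_eq,
    bridgeGram_congr hau fun s hs => h s ⟨hs.1, hs.2.trans hub⟩,
    bridgeGram_congr hub fun s hs => h s ⟨hau.trans hs.1, hs.2⟩]

theorem limitStat_congr (hau : a ≤ u) (hub : u ≤ b) (h : ∀ s ∈ Set.Icc a b, w s = w' s) :
    limitStat w a u b = limitStat w' a u b := by
  rw [limitStat_eq, limitStat_eq, limitNormalizer_congr hau hub h]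
  simp only [limitContrast, bridge, h a ⟨le_rfl, hau.trans hub⟩, h u ⟨hau, hub⟩,
    h b ⟨hau.trans hub, le_rfl⟩]

theorem finMax_congr {α : Type*} {S : Finset α} {f g : α → ℝ} (h : ∀ a ∈ S, f a = g a) :
    finMax S f = finMax S g := by
  by_cases hS : S.Nonempty
  · rw [finMax, finMax, dif_pos hS, dif_pos hS]
    exact Finset.sup'_congr hS rfl h
  · rw [finMax, finMax, dif_neg hS, dif_neg hS]

theorem limitSup_congr {ε : ℝ} (hε : 0 < ε)
    (h : ∀ i j u, IsWindow ε i j u → windowStat w ε i j u = windowStat w' ε i j u) (U : Set ℝ) :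
    limitSup w ε U = limitSup w' ε U := by
  refine iSup_congr fun u => finMax_congr fun q hq => ?_
  obtain ⟨i, j, hij, rfl⟩ := (mem_limitWindows hε).1 hq
  exact h i j u hij

end Congr

theorem det_matrixSqrt_ne_zero {S : Matrix (Fin d) (Fin d) ℝ} (hS : S.PosDef) :
    (matrixSqrt S).det ≠ 0 := by
  intro h
  have h1 : matrixSqrt S * matrixSqrt S = S := by
    open scoped MatrixOrder in
    exact CFC.sqrt_mul_sqrt_self S hS.posSemidef.nonneg
  have h2 := congrArg Matrix.det h1
  rw [Matrix.det_mul, h, zero_mul] at h2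
  exact hS.det_pos.ne h2

section ScaledPath

variable {Ω : Type*} {B : Fin d → ℝ≥0 → Ω → ℝ} {ω : Ω} (hc : Continuous (pathOf B ω))
  (S : Matrix (Fin d) (Fin d) ℝ)
include hc

theorem pathFun_scaledPath (s : ℝ) : pathFun (scaledPath S B ω) s =
    matrixSqrt S *ᵥ pathOf B ω (Set.projIcc (0 : ℝ) 1 zero_le_one s) := by
  have h : Continuous fun r : unitInterval =>
      WithLp.toLp 2 (matrixSqrt S *ᵥ pathOf B ω r) := by
    have h1 : Continuous fun r : unitInterval => matrixSqrt S *ᵥ pathOf B ω r :=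
      continuous_const.matrix_mulVec (hc.comp continuous_subtype_val)
    fun_prop
  simp only [pathFun, scaledPath, ofContinuous, dif_pos h]

theorem pathFun_scaledPath_of_mem {s : ℝ} (hs : s ∈ Set.Icc (0 : ℝ) 1) :
    pathFun (scaledPath S B ω) s = matrixSqrt S *ᵥ pathOf B ω s := by
  rw [pathFun_scaledPath hc, Set.projIcc_of_mem zero_le_one hs]

theorem continuous_pathFun_scaledPath : Continuous (pathFun (scaledPath S B ω)) := by
  simp only [funext (pathFun_scaledPath hc S)]
  exact continuous_const.matrix_mulVec
    (hc.comp (continuous_subtype_val.comp continuous_projIcc))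

variable {S} {ε : ℝ} (hε : 0 < ε) (hS : S.PosDef)
include hε hS

theorem windowStat_scaledPath {i j : ℕ} {u : ℝ} (h : IsWindow ε i j u) :
    windowStat (pathFun (scaledPath S B ω)) ε i j u = windowStat (pathOf B ω) ε i j u := by
  rw [windowStat, windowStat, ← limitStat_mulVec (det_matrixSqrt_ne_zero hS) hc]
  refine limitStat_congr (by linarith [h.left_pos hε]) (by linarith [h.right_pos hε])
    fun s hs => pathFun_scaledPath_of_mem hc S ⟨?_, ?_⟩
  · linarith [hs.1, h.left_le]
  · linarith [hs.2, h.right_le]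

theorem isRegular_scaledPath (hreg : IsRegular (pathOf B ω) ε) :
    IsRegular (pathFun (scaledPath S B ω)) ε := by
  refine ⟨continuous_pathFun_scaledPath hc S, fun i j u h => ?_⟩
  rw [limitNormalizer_congr (w' := fun s => matrixSqrt S *ᵥ pathOf B ω s)
    (by linarith [h.left_pos hε]) (by linarith [h.right_pos hε]) fun s hs =>
      pathFun_scaledPath_of_mem hc S ⟨by linarith [hs.1, h.left_le], by linarith [hs.2, h.right_le]⟩,
    limitNormalizer_mulVec _ hc, Matrix.det_mul, Matrix.det_mul, Matrix.det_transpose]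
  exact mul_ne_zero (mul_ne_zero (det_matrixSqrt_ne_zero hS) (hreg.det_ne_zero i j u h))
    (det_matrixSqrt_ne_zero hS)

end ScaledPath

/-! ### Single observation remainders under stationarity -/

section Stationary

variable {Ω : Type*} [MeasurableSpace Ω] {P : Measure Ω} [IsProbabilityMeasure P]
  {Y : ℕ → Ω → EuclideanSpace ℝ (Fin p)}

/-- The law of `Y (t n + 1)` is that of `Y 1` wherever `t n` is, so the exceptional probabilities
are those of `g (Y 1) / n`, which tends to zero pointwise. -/
theorem IsStationary.tendstoInMeasure_div (hY : ∀ t, Measurable (Y t)) (hstat : IsStationary Y P)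
    {g : EuclideanSpace ℝ (Fin p) → ℝ} (hg : Measurable g) (t : ℕ → ℕ) :
    TendstoInMeasure P (fun n ω => g (Y (t n + 1) ω) / n) atTop fun _ => (0 : ℝ) := by
  have h1 : TendstoInMeasure P (fun (n : ℕ) ω => g (Y 1 ω) / n) atTop fun _ => (0 : ℝ) := by
    refine tendstoInMeasure_of_tendsto_ae
      (fun n => ((hg.comp (hY 1)).div_const _).aestronglyMeasurable)
      (Eventually.of_forall fun ω => ?_)
    exact tendsto_const_nhds.div_atTop tendsto_natCast_atTop_atTop
  intro δ hδ
  refine (h1 δ hδ).congr fun n => ?_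
  have hid : IdentDistrib (Y (t n + 1)) (Y 1) P P := by
    have := (hstat (t n)).comp (measurable_pi_apply 0)
    have e : 0 + 1 + t n = t n + 1 := by omega
    simpa only [Function.comp_def, e] using this
  have hset : MeasurableSet {x : EuclideanSpace ℝ (Fin p) | δ ≤ edist (g x / n) 0} :=
    measurableSet_le measurable_const (Measurable.edist (hg.div_const _) measurable_const)
  exact (hid.measure_mem_eq hset).symm

omit [IsProbabilityMeasure P] in
theorem tendstoInMeasure_add_zero {f g : ℕ → Ω → ℝ}
    (hf : TendstoInMeasure P f atTop fun _ => (0 : ℝ))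
    (hg : TendstoInMeasure P g atTop fun _ => (0 : ℝ)) :
    TendstoInMeasure P (fun n ω => f n ω + g n ω) atTop fun _ => (0 : ℝ) := by
  intro δ hδ
  have h := (hf (δ / 2) (ENNReal.half_pos hδ.ne')).add (hg (δ / 2) (ENNReal.half_pos hδ.ne'))
  rw [add_zero] at h
  refine tendsto_of_tendsto_of_tendsto_of_le_of_le tendsto_const_nhds h (fun _ => zero_le)
    fun n => (measure_mono fun ω hω => ?_).trans (measure_union_le _ _)
  by_contra hcon
  simp only [Set.mem_union, Set.mem_ofPred_eq, not_or, not_le] at hcon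
  have h1 : edist (f n ω + g n ω) (0 + 0) < δ / 2 + δ / 2 :=
    (edist_add_add_le _ _ _ _).trans_lt (ENNReal.add_lt_add hcon.1 hcon.2)
  rw [ENNReal.add_halves, add_zero] at h1
  exact absurd h1 (not_lt.2 hω)

variable {θ : Measure (EuclideanSpace ℝ (Fin p)) → EuclideanSpace ℝ (Fin d)}
  {θ₀ : EuclideanSpace ℝ (Fin d)} {ξ : EuclideanSpace ℝ (Fin p) → EuclideanSpace ℝ (Fin d)}

/-- The remainder of one observation is a fixed function of that observation, so stationarity
applies to it. -/
theorem remainder_self (y : ℕ → EuclideanSpace ℝ (Fin p)) (t : ℕ) :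
    remainder θ θ₀ ξ y t t = remainder θ θ₀ ξ (fun _ => y t) 1 1 := by
  simp [remainder, thetaHat, empirical]

theorem IsStationary.tendstoInMeasure_gridRemainder (hY : ∀ t, Measurable (Y t))
    (hstat : IsStationary Y P)
    (hθ : ∀ a b : ℕ, 1 ≤ a → a ≤ b →
      Measurable fun y : ℕ → EuclideanSpace ℝ (Fin p) => thetaHat θ y a b)
    (hξ : Measurable ξ) (ε : ℝ) (i j a b : ℕ) :
    TendstoInMeasure P (fun n ω => gridRemainder θ θ₀ ξ ε n (fun t => Y t ω) i j a b) atTop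
      fun _ => (0 : ℝ) := by
  have hg : Measurable fun x => ‖remainder θ θ₀ ξ (fun _ => x) 1 1‖ := by
    have h1 : Measurable fun x : EuclideanSpace ℝ (Fin p) => thetaHat θ (fun _ => x) 1 1 :=
      (hθ 1 1 le_rfl le_rfl).comp (measurable_pi_lambda _ fun _ => measurable_id)
    simp only [remainder, Finset.Icc_self, Finset.sum_singleton]
    fun_prop
  have h : ∀ t : ℕ → ℕ, TendstoInMeasure P
      (fun n ω => ‖remainder θ θ₀ ξ (fun t => Y t ω) (t n + 1) (t n + 1)‖ / n) atTop
      fun _ => (0 : ℝ) := by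
    intro t
    simp only [remainder_self (fun t => Y t _)]
    exact hstat.tendstoInMeasure_div hY hg t
  exact tendstoInMeasure_add_zero (tendstoInMeasure_add_zero (tendstoInMeasure_add_zero
    (h fun n => gridPoint ε n i j a b - i * windowSize ε n)
    (h fun n => gridPoint ε n i j a b - 1)) (h fun n => gridPoint ε n i j a b))
    (h fun n => gridPoint ε n i j a b + j * windowSize ε n - 1)

end Stationary

end

/-! ### Assembly of the deterministic and probabilistic parts -/

section

variable {p d : ℕ}

theorem tendstoInDistribution_maxSN {Ω Ω' : Type*} [MeasurableSpace Ω] [MeasurableSpace Ω']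
    {P : Measure Ω} [IsProbabilityMeasure P] {P' : Measure Ω'} [IsProbabilityMeasure P']
    {ε : ℝ} (hε : 0 < ε) (hε' : ε < 1 / 2)
    {Y : ℕ → Ω → EuclideanSpace ℝ (Fin p)} (hY : ∀ t, Measurable (Y t))
    (hstat : IsStationary Y P)
    {θ : Measure (EuclideanSpace ℝ (Fin p)) → EuclideanSpace ℝ (Fin d)}
    (hθ : ∀ a b : ℕ, 1 ≤ a → a ≤ b →
      Measurable fun y : ℕ → EuclideanSpace ℝ (Fin p) => thetaHat θ y a b)
    {θ₀ : EuclideanSpace ℝ (Fin d)}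
    {ξ : EuclideanSpace ℝ (Fin p) → EuclideanSpace ℝ (Fin d)} (hξ : Measurable ξ)
    {W : Ω' → DSpace d} (hW : ∀ᵐ ω ∂P', IsRegular (pathFun (W ω)) ε)
    (hFCLT : TendstoInDistribution (fun (n : ℕ) ω => partialSumPath ξ n fun t => Y t ω) atTop
      W (fun _ => P) P')
    (hrem : TendstoInMeasure P
      (fun (n : ℕ) ω => supRemainder θ θ₀ ξ n (fun t => Y t ω) / √(n : ℝ)) atTop
      fun _ => (0 : ℝ)) :
    TendstoInDistribution (fun (n : ℕ) ω => maxSN θ (fun t => Y t ω) ε n) atTop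
      (fun ω => limitSup (pathFun (W ω)) ε (Set.Icc ε (1 - ε))) (fun _ => P) P' := by
  -- Index `0` carries the uniform remainder; the successors enumerate the grid parameters `(i, j,
  -- a, b)`.
  let ρ : ℕ → ℕ → Ω → ℝ := fun a n ω => a.casesOn
    (supRemainder θ θ₀ ξ n (fun t => Y t ω) / √(n : ℝ)) fun e =>
      let q := Denumerable.ofNat (ℕ × ℕ × ℕ × ℕ) e
      gridRemainder θ θ₀ ξ ε n (fun t => Y t ω) q.1 q.2.1 q.2.2.1 q.2.2.2
  have hρ : ∀ a, TendstoInMeasure P (ρ a) atTop fun _ => (0 : ℝ) := by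
    rintro (_ | e)
    · exact hrem
    · exact hstat.tendstoInMeasure_gridRemainder hY hθ hξ ε _ _ _ _
  refine tendstoInDistribution_of_forall_filter (E := DSpace d) hFCLT
    (fun n => ((measurable_maxSN hθ ε n).comp (measurable_pi_lambda _ hY)).aemeasurable)
    (Φ := fun x => limitSup (pathFun x) ε (Set.Icc ε (1 - ε)))
    (C := {x | IsRegular (pathFun x) ε})
    (aemeasurable_comp_of_continuousOn hFCLT.aemeasurable_limit hW (continuousOn_limitSup hε hε'))
    hρ hW fun x hx l hl hX hl0 => ?_
  refine IsApprox.tendsto_maxSN (θ₀ := θ₀) (ξ := ξ) (n := Prod.fst) (y := fun q t => Y t q.2)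
    ⟨hl, tendstoUniformly_pathFun hx.continuous hX, hl0 0⟩ hx hε hε' fun i j a b => ?_
  have h := hl0 (Encodable.encode (i, j, a, b) + 1)
  simpa only [ρ, Denumerable.ofNat_encode] using h

theorem IsBrownianVec.ae_isRegular {Ω : Type*} [MeasurableSpace Ω] {P : Measure Ω}
    [IsProbabilityMeasure P] {B : Fin d → ℝ≥0 → Ω → ℝ} (hB : IsBrownianVec B P) {ε : ℝ}
    (hε : 0 < ε) : ∀ᵐ ω ∂P, IsRegular (pathOf B ω) ε := by
  filter_upwards [hB.ae_continuous, hB.ae_posDef] with ω hc hpd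
  exact ⟨hc, fun i j u h => (hpd _ _ _ (by linarith [h.left_le]) (by linarith [h.left_pos hε])
    (by linarith [h.right_pos hε])).det_pos.ne'⟩

end

end SNCP

end

theorem proposition1 {Ω Ω' : Type*} [MeasurableSpace Ω] [MeasurableSpace Ω']
    (P : Measure Ω) [IsProbabilityMeasure P] (P' : Measure Ω') [IsProbabilityMeasure P']
    (p d : ℕ) (hd : 1 ≤ d) (ε : ℝ) (hε : 0 < ε) (hε' : ε < 1 / 2)
    -- the time series without change-point
    (Y : ℕ → Ω → EuclideanSpace ℝ (Fin p)) (hY : ∀ t, Measurable (Y t))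
    (hstat : SNCP.IsStationary Y P)
    -- the functional; its subsample estimators are measurable functions of the data
    (θ : Measure (EuclideanSpace ℝ (Fin p)) → EuclideanSpace ℝ (Fin d))
    (hθ : ∀ a b : ℕ, 1 ≤ a → a ≤ b →
      Measurable fun y : ℕ → EuclideanSpace ℝ (Fin p) => SNCP.thetaHat θ y a b)
    (ξ : EuclideanSpace ℝ (Fin p) → EuclideanSpace ℝ (Fin d)) (hξ : Measurable ξ)
    -- the limiting Brownian motion
    (B : Fin d → ℝ≥0 → Ω' → ℝ) (hB : SNCP.IsBrownianVec B P')
    -- the functional central limit theorem for the influence function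
    (S : Matrix (Fin d) (Fin d) ℝ) (hS : S.PosDef)
    (hFCLT : TendstoInDistribution
      (fun (n : ℕ) ω => SNCP.partialSumPath ξ n fun t => Y t ω) atTop
      (SNCP.scaledPath S B) (fun _ => P) P')
    -- the remainders are uniformly `o_p(n^{1/2})`
    (hrem : TendstoInMeasure P
      (fun (n : ℕ) ω => SNCP.supRemainder θ (θ (P.map (Y 1))) ξ n (fun t => Y t ω) / √(n : ℝ))
      atTop fun _ => (0 : ℝ)) :
    -- the limit is almost surely well defined and finite
    (∀ᵐ ω ∂P', (∀ u ∈ Set.Icc ε (1 - ε), ∀ q ∈ SNCP.limitWindows ε u,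
        (SNCP.limitNormalizer (SNCP.pathOf B ω) q.1 u q.2).PosDef) ∧
      BddAbove (SNCP.limitMax (SNCP.pathOf B ω) ε '' Set.Icc ε (1 - ε))) ∧
    -- convergence in distribution, the supremum being taken over `[ε, 1 - ε]`
    TendstoInDistribution (fun (n : ℕ) ω => SNCP.maxSN θ (fun t => Y t ω) ε n) atTop
      (fun ω => SNCP.limitSup (SNCP.pathOf B ω) ε (Set.Icc ε (1 - ε))) (fun _ => P) P' ∧
    -- if `1 / ε` is not an integer, the open interval gives the same limit
    ((∀ m : ℕ, (m : ℝ) * ε ≠ 1) →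
      TendstoInDistribution (fun (n : ℕ) ω => SNCP.maxSN θ (fun t => Y t ω) ε n) atTop
        (fun ω => SNCP.limitSup (SNCP.pathOf B ω) ε (Set.Ioo ε (1 - ε))) (fun _ => P) P') := by
  have hreg := hB.ae_isRegular hε
  have hcont := hB.ae_continuous
  have hlim := SNCP.tendstoInDistribution_maxSN hε hε' hY hstat hθ hξ (W := SNCP.scaledPath S B)
    (by filter_upwards [hreg, hcont] with ω h1 h2 using SNCP.isRegular_scaledPath h2 hε hS h1)
    hFCLT hrem
  -- The matrix square root is removed here, window by window.
  have hIcc := hlim.congr (fun _ => ae_eq_refl _) (T := fun ω =>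
    SNCP.limitSup (SNCP.pathOf B ω) ε (Set.Icc ε (1 - ε))) (by
      filter_upwards [hcont] with ω hc
      exact SNCP.limitSup_congr hε (fun i j u h => SNCP.windowStat_scaledPath hc hε hS h) _)
  refine ⟨?_, hIcc, fun hint => hIcc.congr (fun _ => ae_eq_refl _) ?_⟩
  · filter_upwards [hreg, hB.ae_posDef] with ω h1 hpd
    refine ⟨fun u hu q hq => ?_,
      (h1.bddAbove_windowValues hε).mono (SNCP.limitMax_image_subset hε)⟩
    obtain ⟨i, j, h, rfl⟩ := (SNCP.mem_limitWindows hε).1 hq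
    exact hpd _ _ _ (by linarith [h.left_le]) (by linarith [h.left_pos hε])
      (by linarith [h.right_pos hε])
  · filter_upwards [hreg] with ω h1
    exact (h1.limitSup_Ioo hε hε' hint).symm
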